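/- Let $N\ge 1$ be an integer, let $0<\theta\le 2$, and put $p_\theta:=1+\theta/N$. For $x\in\mathbb{R}^N$ and $t>0$ let $$\Gamma_\theta(x,t)=(2\pi)^{-N}\int_{\mathbb{R}^N}e^{i x\cdot\xi}e^{-t|\xi|^\theta}\,d\xi$$ be the fundamental solution of $\partial_t u+(-\Delta)^{\theta/2}u=0$ in $\mathbb{R}^N\times(0,\infty)$, and for a nonnegative Radon measure $\mu$ on $\mathbb{R}^N$ put $[S(t)\mu](x)=\int_{\mathbb{R}^N}\Gamma_\theta(x-y,t)\,d\mu(y)$. For $T>0$ let $Q_T:=\mathbb{R}^N\times(0,T)$. A solution in $Q_T$ of the problem $$\text{(P)}\qquad \partial_t u+(-\Delta)^{\theta/2}u=F(u)\quad (x\in\mathbb{R}^N,\ t>0),\qquad u(0)=\mu\ \text{ in }\mathbb{R}^N,$$ is a nonnegative, Lebesgue measurable, finite function $u$ on $Q_T$ such that $$u(x,t)=[S(t)\mu](x)+\int_0^t\int_{\mathbb{R}^N}\Gamma_\theta(x-y,t-s)F(u(y,s))\,dy\,ds\qquad\text{for a.a. }(x,t)\in Q_T.$$ **Theorem.** Let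 $F$ be a nonnegative continuous function on $[0,\infty)$ such that (A1) $R\ge 0$ is such that the function $\tau\mapsto\tau^{-1}F(\tau)$ is increasing (not necessarily strictly) on $(R,\infty)$; (A2) $\displaystyle\int_1^\infty\tau^{-p_\theta-1}F(\tau)\,d\tau<\infty$. If $\mu$ is a nonnegative Radon measure on $\mathbb{R}^N$ with $\displaystyle\sup_{x\in\mathbb{R}^N}\mu(B(x,1))<\infty$, where $B(x,1)$ is the Euclidean ball with centre $x$ and radius $1$, then there exist $T>0$, $C>0$ and a solution $u$ of (P) in $Q_T$ such that $$0\le u(x,t)\le 2[S(t)\mu](x)+R\le C\,t^{-N/\theta}\qquad\text{for all }(x,t)\in Q_T.$$ -/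

import Mathlib

open MeasureTheory Set
open scoped ENNReal

noncomputable section

namespace FracHeat

/-- The fundamental solution `Γ_θ(x,t)` of `∂_t u + (-Δ)^{θ/2} u = 0` in `ℝ^N × (0,∞)`, i.e. the
inverse Fourier transform of `exp(-t|ξ|^θ)`. With Mathlib's normalization of the Fourier transform
(character `exp(2πi⟨x,ξ⟩)`), the symbol of `(-Δ)^{θ/2}` is `(2π|ξ|)^θ`. The value of the transform
is real because the transformed function is real and even. -/
def kernel (N : ℕ) (θ : ℝ) (x : EuclideanSpace ℝ (Fin N)) (t : ℝ) : ℝ :=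
  (FourierTransformInv.fourierInv
    (fun ξ : EuclideanSpace ℝ (Fin N) =>
      ((Real.exp (-t * (2 * Real.pi * ‖ξ‖) ^ θ) : ℝ) : ℂ)) x).re

/-- `[S(t)μ](x) = ∫ Γ_θ(x - y, t) dμ(y)`, a value in `[0,∞]`. -/
def semigroup {N : ℕ} (θ : ℝ) (t : ℝ) (μ : Measure (EuclideanSpace ℝ (Fin N)))
    (x : EuclideanSpace ℝ (Fin N)) : ℝ≥0∞ :=
  ∫⁻ y, ENNReal.ofReal (kernel N θ (x - y) t) ∂μ

/-- `∫_0^t ∫ Γ_θ(x - y, t - s) F(u(y,s)) dy ds`, a value in `[0,∞]`. -/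
def duhamel {N : ℕ} (θ : ℝ) (F : ℝ → ℝ) (u : EuclideanSpace ℝ (Fin N) → ℝ → ℝ)
    (x : EuclideanSpace ℝ (Fin N)) (t : ℝ) : ℝ≥0∞ :=
  ∫⁻ s in Ioo 0 t, ∫⁻ y,
    ENNReal.ofReal (kernel N θ (x - y) (t - s)) * ENNReal.ofReal (F (u y s))

/-- The space-time strip `Q_T = ℝ^N × (0,T)`. -/
def strip (N : ℕ) (T : ℝ) : Set (EuclideanSpace ℝ (Fin N) × ℝ) := univ ×ˢ Ioo 0 T

/-- `u` is a solution in `Q_T` of problem (P):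
`∂_t u + (-Δ)^{θ/2} u = F(u)` for `t > 0`, `u(0) = μ` in `ℝ^N`.
This means that `u` is a nonnegative, Lebesgue measurable, finite function on `Q_T` that satisfies
the integral equation
`u(x,t) = ∫ Γ_θ(x - y, t) dμ(y) + ∫_0^t ∫ Γ_θ(x - y, t - s) F(u(y,s)) dy ds`
for almost every `(x,t)` in `Q_T`. The integrands are nonnegative, so the equation is one
in `[0,∞]`; as its left side is finite, both integrals are finite where it holds. -/
structure IsSolution {N : ℕ} (θ : ℝ) (F : ℝ → ℝ) (μ : Measure (EuclideanSpace ℝ (Fin N)))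
    (T : ℝ) (u : EuclideanSpace ℝ (Fin N) → ℝ → ℝ) : Prop where
  measurable : AEMeasurable (fun z : EuclideanSpace ℝ (Fin N) × ℝ => u z.1 z.2)
    (volume.restrict (strip N T))
  nonneg : ∀ x, ∀ t ∈ Ioo 0 T, 0 ≤ u x t
  equation : ∀ᵐ z ∂(volume.restrict (strip N T)),
    ENNReal.ofReal (u z.1 z.2) = semigroup θ z.2 μ z.1 + duhamel θ F u z.1 z.2

end FracHeat

end

/-! The function `w = 2 S(t)μ + R` is a supersolution for small times. The uniform bound on unit
balls gives `w ≤ τ(s) = C s^(-N/θ)`. By (A1), the running maximum of `F` at `w` is at most `M +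
(F(τ)/τ) w`, where `M` bounds `F` on `[0,R]`. The substitution `τ = C s^(-N/θ)` turns (A2) into
integrability of `s ↦ F(τ(s))/τ(s)` near 0. Since `S(t-s)S(s)μ = S(t)μ`, the Duhamel term of `w` is
at most `M t + (∫ F(τ)/τ) w`, and this is at most `R/2 + w/2` for small `t`
(`volterra_shiftedSup_le`).

Passing from the supersolution to a solution is not a plain monotone iteration, because `F` may be
neither monotone nor Lipschitz on `[0,R]`. It is replaced by the majorants `F_K(v) = sup_{σ ≤ v} (F
σ - K(v - σ))`. They decrease to `F`, and `F_K(v) + K v` is nondecreasing. Adding `K u` to both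
sides of the equation gives an equivalent integral equation with weight `exp(-K t)`, where monotone
iteration works. The solution for `K` is a supersolution for `K + 1`, so a decreasing sequence of
solutions arises, and dominated convergence yields a solution for `F`
(`exists_solution_of_supersolution`).

The kernel must be nonnegative, radially nonincreasing, of mass one, and a semigroup. The first two
properties come from writing `|ξ|^θ` as a Lévy integral of `1 - exp(-r|ξ|²)`: the symbol is then a
limit of exponentials of mixtures of Gaussians. The other two follow by Fourier inversion. -/

noncomputable section

/-! ### Functions whose Gaussian-regularized transforms are nonnegative and radially nonincreasing.
-/

namespace FracHeat

open Filter Topology Real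

variable {V : Type*} [NormedAddCommGroup V] [InnerProductSpace ℝ V] [FiniteDimensional ℝ V]
  [MeasurableSpace V] [BorelSpace V]

/-- The cosine transform of `f` times a Gaussian of parameter `s`. -/
def gaussCos (f : V → ℝ) (s : ℝ) (x : V) : ℝ :=
  ∫ ξ, f ξ * (Real.exp (-s * ‖ξ‖ ^ 2) * Real.cos (2 * π * inner ℝ ξ x))

/-- Bounded measurable functions all of whose Gaussian-regularized cosine transforms are
nonnegative and radially nonincreasing. -/
structure RadialPosDef (f : V → ℝ) : Prop where
  meas : Measurable f
  bdd : ∃ C, ∀ ξ, |f ξ| ≤ C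
  nonneg : ∀ s > 0, ∀ x, 0 ≤ gaussCos f s x
  anti : ∀ s > 0, ∀ x y : V, ‖x‖ ≤ ‖y‖ → gaussCos f s y ≤ gaussCos f s x

lemma integrable_exp_neg_mul_sq_norm {s : ℝ} (hs : 0 < s) :
    Integrable (fun ξ : V => Real.exp (-s * ‖ξ‖ ^ 2)) := by
  have h := (GaussianFourier.integrable_cexp_neg_mul_sq_norm_add (V := V)
    (b := (s : ℂ)) (by simpa using hs) 0 0).norm
  refine h.congr (Eventually.of_forall fun ξ => ?_)
  simp only [Complex.norm_exp]
  congr 1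
  simp only [zero_mul, add_zero]
  rw [show -(s : ℂ) * (‖ξ‖ : ℂ) ^ 2 = ((-s * ‖ξ‖ ^ 2 : ℝ) : ℂ) by push_cast; ring]
  exact Complex.ofReal_re _

lemma integrable_gauss_mul_cos {s : ℝ} (hs : 0 < s) (x : V) :
    Integrable (fun ξ : V => Real.exp (-s * ‖ξ‖ ^ 2) * Real.cos (2 * π * inner ℝ ξ x)) := by
  refine (integrable_exp_neg_mul_sq_norm hs).mul_bdd (c := 1) ?_ ?_
  · exact (by fun_prop : Continuous fun ξ : V => Real.cos (2 * π * inner ℝ ξ x)).aestronglyMeasurable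
  · exact Eventually.of_forall fun ξ => Real.abs_cos_le_one _

lemma integrable_gaussCos {f : V → ℝ} (hf : Measurable f) {C : ℝ} (hC : ∀ ξ, |f ξ| ≤ C)
    {s : ℝ} (hs : 0 < s) (x : V) :
    Integrable
      (fun ξ : V => f ξ * (Real.exp (-s * ‖ξ‖ ^ 2) * Real.cos (2 * π * inner ℝ ξ x))) :=
  (integrable_gauss_mul_cos hs x).bdd_mul hf.aestronglyMeasurable
    (Eventually.of_forall hC)

lemma integral_mul_cos_eq_re_fourierInv {f : V → ℝ} (hf : Integrable f) (x : V) :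
    ∫ ξ, f ξ * Real.cos (2 * π * inner ℝ ξ x)
      = (FourierTransformInv.fourierInv (fun ξ : V => ((f ξ : ℝ) : ℂ)) x).re := by
  rw [Real.fourierInv_eq']
  have hi : Integrable (fun ξ : V =>
      Complex.exp (((2 * π * inner ℝ ξ x : ℝ) : ℂ) * Complex.I) • ((f ξ : ℝ) : ℂ)) := by
    refine (hf.ofReal (𝕜 := ℂ)).bdd_mul (c := 1) ?_ ?_
    · exact (by fun_prop : Continuous fun ξ : V =>
        Complex.exp (((2 * π * inner ℝ ξ x : ℝ) : ℂ) * Complex.I)).aestronglyMeasurable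
    · exact Eventually.of_forall fun ξ => (Complex.norm_exp_ofReal_mul_I _).le
  have := integral_re hi
  simp only [RCLike.re_to_complex] at this
  rw [← this]
  refine integral_congr_ae (Eventually.of_forall fun ξ => ?_)
  simp only [smul_eq_mul, Complex.re_mul_ofReal, Complex.exp_ofReal_mul_I_re]
  ring

lemma gaussCos_one {s : ℝ} (hs : 0 < s) (x : V) :
    gaussCos (fun _ => 1) s x
      = (π / s) ^ (Module.finrank ℝ V / 2 : ℝ) * Real.exp (-π ^ 2 * ‖x‖ ^ 2 / s) := by
  have h1 := integral_mul_cos_eq_re_fourierInv (integrable_exp_neg_mul_sq_norm (V := V) hs) x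
  simp only [gaussCos, one_mul]
  rw [h1, Real.fourierInv_eq_fourier_neg]
  have h2 := fourier_gaussian_innerProductSpace (V := V) (b := (s : ℂ)) (by simpa using hs) (-x)
  have h3 : (fun ξ : V => ((Real.exp (-s * ‖ξ‖ ^ 2) : ℝ) : ℂ))
      = fun v : V => Complex.exp (-(s : ℂ) * ‖v‖ ^ 2) := by
    funext v; push_cast; rfl
  rw [h3, h2, norm_neg]
  have h4 : ((π : ℂ) / (s : ℂ)) ^ (Module.finrank ℝ V / 2 : ℂ)
      = (((π / s) ^ (Module.finrank ℝ V / 2 : ℝ) : ℝ) : ℂ) := by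
    rw [Complex.ofReal_cpow (by positivity)]; push_cast; rfl
  have h5 : Complex.exp (-(π : ℂ) ^ 2 * (‖x‖ : ℂ) ^ 2 / (s : ℂ))
      = ((Real.exp (-π ^ 2 * ‖x‖ ^ 2 / s) : ℝ) : ℂ) := by push_cast; rfl
  rw [h4, h5, ← Complex.ofReal_mul, Complex.ofReal_re]

namespace RadialPosDef

lemma one : RadialPosDef (fun _ : V => (1 : ℝ)) where
  meas := measurable_const
  bdd := ⟨1, fun _ => by simp⟩
  nonneg s hs x := by rw [gaussCos_one hs]; positivity
  anti s hs x y hxy := by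
    rw [gaussCos_one hs, gaussCos_one hs]
    have : ‖x‖ ^ 2 ≤ ‖y‖ ^ 2 := by gcongr
    have h2 : -π ^ 2 * ‖y‖ ^ 2 / s ≤ -π ^ 2 * ‖x‖ ^ 2 / s := by
      refine div_le_div_of_nonneg_right ?_ hs.le
      nlinarith [sq_nonneg π]
    gcongr

/-- A Gaussian factor only moves the regularization parameter from `s` to `r + s`. This is why the
class asks for the sign and the monotonicity at every `s > 0`. -/
lemma mul_gauss {f : V → ℝ} (hf : RadialPosDef f) {r : ℝ} (hr : 0 ≤ r) :
    RadialPosDef (fun ξ => f ξ * Real.exp (-r * ‖ξ‖ ^ 2)) := by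
  have key : ∀ s x, gaussCos (fun ξ => f ξ * Real.exp (-r * ‖ξ‖ ^ 2)) s x
      = gaussCos f (r + s) x := by
    intro s x
    refine integral_congr_ae (Eventually.of_forall fun ξ => ?_)
    simp only
    rw [show -(r + s) * ‖ξ‖ ^ 2 = -r * ‖ξ‖ ^ 2 + -s * ‖ξ‖ ^ 2 by ring, Real.exp_add]
    ring
  obtain ⟨C, hC⟩ := hf.bdd
  refine ⟨hf.meas.mul (by fun_prop), ⟨C, fun ξ => ?_⟩, fun s hs x => ?_, fun s hs x y h => ?_⟩
  · rw [abs_mul, abs_of_pos (Real.exp_pos _)]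
    calc |f ξ| * Real.exp (-r * ‖ξ‖ ^ 2) ≤ |f ξ| * 1 := by
          gcongr; rw [Real.exp_le_one_iff]; nlinarith [sq_nonneg ‖ξ‖]
      _ ≤ C := by simpa using hC ξ
  · rw [key]; exact hf.nonneg _ (by linarith) _
  · rw [key, key]; exact hf.anti _ (by linarith) _ _ h

lemma add {f g : V → ℝ} (hf : RadialPosDef f) (hg : RadialPosDef g) :
    RadialPosDef (fun ξ => f ξ + g ξ) := by
  obtain ⟨C, hC⟩ := hf.bdd
  obtain ⟨D, hD⟩ := hg.bdd
  have key : ∀ s > 0, ∀ x, gaussCos (fun ξ => f ξ + g ξ) s x = gaussCos f s x + gaussCos g s x := by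
    intro s hs x
    simp only [gaussCos, add_mul]
    exact integral_add (integrable_gaussCos hf.meas hC hs x) (integrable_gaussCos hg.meas hD hs x)
  refine ⟨hf.meas.add hg.meas, ⟨C + D, fun ξ => (abs_add_le _ _).trans (add_le_add (hC ξ) (hD ξ))⟩,
    fun s hs x => ?_, fun s hs x y h => ?_⟩
  · rw [key s hs]; exact add_nonneg (hf.nonneg s hs x) (hg.nonneg s hs x)
  · rw [key s hs, key s hs]; exact add_le_add (hf.anti s hs x y h) (hg.anti s hs x y h)

lemma const_mul {f : V → ℝ} (hf : RadialPosDef f) {c : ℝ} (hc : 0 ≤ c) :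
    RadialPosDef (fun ξ => c * f ξ) := by
  obtain ⟨C, hC⟩ := hf.bdd
  have key : ∀ s x, gaussCos (fun ξ => c * f ξ) s x = c * gaussCos f s x := by
    intro s x
    simp only [gaussCos, mul_assoc]
    exact integral_const_mul _ _
  refine ⟨hf.meas.const_mul c, ⟨c * C, fun ξ => ?_⟩, fun s hs x => ?_, fun s hs x y h => ?_⟩
  · rw [abs_mul, abs_of_nonneg hc]; exact mul_le_mul_of_nonneg_left (hC ξ) hc
  · rw [key]; exact mul_nonneg hc (hf.nonneg s hs x)
  · rw [key, key]; exact mul_le_mul_of_nonneg_left (hf.anti s hs x y h) hc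

lemma sum {f : ℕ → V → ℝ} (hf : ∀ k, RadialPosDef (f k)) (n : ℕ) :
    RadialPosDef (fun ξ => ∑ k ∈ Finset.range n, f k ξ) := by
  induction n with
  | zero => simpa using (one (V := V)).const_mul le_rfl
  | succ n ih => simpa only [Finset.sum_range_succ] using ih.add (hf n)

/-- The regularizing Gaussian makes a uniform bound sufficient for dominated convergence; no
integrability of the functions themselves is needed. -/
lemma of_tendsto {f : ℕ → V → ℝ} {g : V → ℝ} (hf : ∀ n, RadialPosDef (f n)) {C : ℝ}
    (hC : ∀ n ξ, |f n ξ| ≤ C) (hlim : ∀ ξ, Tendsto (fun n => f n ξ) atTop (𝓝 (g ξ))) :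
    RadialPosDef g := by
  have hg : ∀ ξ, |g ξ| ≤ C := fun ξ => le_of_tendsto' (hlim ξ).abs fun n => hC n ξ
  have hgm : Measurable g := measurable_of_tendsto_metrizable (fun n => (hf n).meas)
    (tendsto_pi_nhds.2 hlim)
  have key : ∀ s > 0, ∀ x, Tendsto (fun n => gaussCos (f n) s x) atTop (𝓝 (gaussCos g s x)) := by
    intro s hs x
    refine tendsto_integral_of_dominated_convergence
      (fun ξ => C * |Real.exp (-s * ‖ξ‖ ^ 2) * Real.cos (2 * π * inner ℝ ξ x)|)
      (fun n => (integrable_gaussCos (hf n).meas (hC n) hs x).aestronglyMeasurable)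
      ((integrable_gauss_mul_cos hs x).abs.const_mul C) (fun n => ?_) ?_
    · refine Eventually.of_forall fun ξ => ?_
      rw [Real.norm_eq_abs, abs_mul]
      exact mul_le_mul_of_nonneg_right (hC n ξ) (abs_nonneg _)
    · exact Eventually.of_forall fun ξ => (hlim ξ).mul_const _
  exact ⟨hgm, ⟨C, hg⟩, fun s hs x => ge_of_tendsto' (key s hs x) fun n => (hf n).nonneg s hs x,
    fun s hs x y h => le_of_tendsto_of_tendsto' (key s hs y) (key s hs x)
      fun n => (hf n).anti s hs x y h⟩

lemma mixture {ν : Measure ℝ} [SFinite ν] {ρ : ℝ → ℝ} (hρ : Integrable ρ ν) (hρ0 : ∀ r, 0 ≤ ρ r)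
    {f : ℝ → V → ℝ} (hfm : Measurable (Function.uncurry f)) {C : ℝ} (hC : ∀ r ξ, |f r ξ| ≤ C)
    (hf : ∀ r, RadialPosDef (f r)) : RadialPosDef (fun ξ => ∫ r, ρ r * f r ξ ∂ν) := by
  have hsm : StronglyMeasurable (fun p : V × ℝ => f p.2 p.1) :=
    (hfm.comp measurable_swap).stronglyMeasurable
  have hprod : ∀ s > 0, ∀ x : V, Integrable (fun p : V × ℝ => (ρ p.2 * f p.2 p.1)
      * (Real.exp (-s * ‖p.1‖ ^ 2) * Real.cos (2 * π * inner ℝ p.1 x))) (volume.prod ν) := by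
    intro s hs x
    have h := (integrable_gauss_mul_cos hs x).mul_prod hρ
    refine (h.bdd_mul (c := C) hsm.aestronglyMeasurable
      (Eventually.of_forall fun p => hC p.2 p.1)).congr (Eventually.of_forall fun p => ?_)
    simp only
    ring
  have key : ∀ s > 0, ∀ x, gaussCos (fun ξ => ∫ r, ρ r * f r ξ ∂ν) s x
      = ∫ r, ρ r * gaussCos (f r) s x ∂ν := by
    intro s hs x
    simp only [gaussCos, ← integral_mul_const, ← integral_const_mul]
    rw [integral_integral_swap (hprod s hs x)]
    refine integral_congr_ae (Eventually.of_forall fun r => ?_)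
    simp only [mul_assoc]
  have hint : ∀ s > 0, ∀ x, Integrable (fun r => ρ r * gaussCos (f r) s x) ν := by
    intro s hs x
    refine (hprod s hs x).integral_prod_right.congr (Eventually.of_forall fun r => ?_)
    simp only [gaussCos, ← integral_const_mul, mul_assoc]
  refine ⟨?_, ⟨(∫ r, ρ r ∂ν) * C, fun ξ => ?_⟩, fun s hs x => ?_, fun s hs x y h => ?_⟩
  -- The density is only a.e. measurable, so a measurable representative is used to see that the
  -- mixture is measurable in `ξ`.
  · obtain ⟨ρ', hρ', he⟩ := hρ.aestronglyMeasurable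
    have : (fun ξ => ∫ r, ρ r * f r ξ ∂ν) = fun ξ => ∫ r, ρ' r * f r ξ ∂ν := by
      funext ξ
      refine integral_congr_ae ?_
      filter_upwards [he] with r hr
      rw [hr]
    rw [this]
    refine StronglyMeasurable.measurable ?_
    exact StronglyMeasurable.integral_prod_right'
      (f := fun p : V × ℝ => ρ' p.2 * f p.2 p.1) ((hρ'.comp_measurable measurable_snd).mul hsm)
  · rw [← integral_mul_const, ← Real.norm_eq_abs]
    refine norm_integral_le_of_norm_le (hρ.mul_const C) (Eventually.of_forall fun r => ?_)
    rw [Real.norm_eq_abs, abs_mul, abs_of_nonneg (hρ0 r)]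
    exact mul_le_mul_of_nonneg_left (hC r ξ) (hρ0 r)
  · rw [key s hs]
    exact integral_nonneg fun r => mul_nonneg (hρ0 r) ((hf r).nonneg s hs x)
  · rw [key s hs, key s hs]
    exact integral_mono (hint s hs y) (hint s hs x)
      fun r => mul_le_mul_of_nonneg_left ((hf r).anti s hs x y h) (hρ0 r)

/-- The exponential of a bounded function that preserves `RadialPosDef` under multiplication. -/
lemma exp_of_multiplier {g : V → ℝ} {C : ℝ} (hC : ∀ ξ, |g ξ| ≤ C)
    (hg : ∀ f : V → ℝ, RadialPosDef f → RadialPosDef (fun ξ => f ξ * g ξ)) :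
    RadialPosDef (fun ξ => Real.exp (g ξ)) := by
  -- Only multiplication by `g` is known to preserve the class, not arbitrary products; the powers
  -- are therefore built from the constant 1, and the exponential series is summed afterwards.
  have hpow : ∀ k : ℕ, RadialPosDef (fun ξ => g ξ ^ k) := by
    intro k
    induction k with
    | zero => simpa using one (V := V)
    | succ k ih => simpa only [pow_succ] using hg _ ih
  have hterm : ∀ k : ℕ, RadialPosDef (fun ξ => g ξ ^ k / (k.factorial : ℝ)) := by
    intro k
    have := (hpow k).const_mul (c := ((k.factorial : ℝ))⁻¹) (by positivity)
    simpa only [div_eq_inv_mul] using this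
  refine of_tendsto (fun n => sum hterm n) (C := Real.exp C) (fun n ξ => ?_) (fun ξ => ?_)
  · calc |∑ k ∈ Finset.range n, g ξ ^ k / (k.factorial : ℝ)|
        ≤ ∑ k ∈ Finset.range n, |g ξ ^ k / (k.factorial : ℝ)| := Finset.abs_sum_le_sum_abs _ _
      _ = ∑ k ∈ Finset.range n, |g ξ| ^ k / (k.factorial : ℝ) := by
          refine Finset.sum_congr rfl fun k _ => ?_
          rw [abs_div, abs_pow, Nat.abs_cast]
      _ ≤ Real.exp |g ξ| := Real.sum_le_exp_of_nonneg (abs_nonneg _) n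
      _ ≤ Real.exp C := Real.exp_le_exp.2 (hC ξ)
  · have := NormedSpace.expSeries_div_hasSum_exp (g ξ)
    rw [← Real.exp_eq_exp_ℝ] at this
    exact this.tendsto_sum_nat

end RadialPosDef

end FracHeat

/-! ### The Lévy formula for `|ξ|^θ` and the symbol of the semigroup. -/

namespace FracHeat

open Filter Topology Real

/-- Near 0 the bound `1 - exp(-r) ≤ r` leaves `r^(-α)`, integrable as `α < 1`; at infinity the bound
by 1 leaves `r^(-1-α)`, integrable as `α > 0`. -/
lemma integrableOn_one_sub_exp_neg_mul_rpow {α : ℝ} (hα0 : 0 < α) (hα1 : α < 1) :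
    IntegrableOn (fun r : ℝ => (1 - Real.exp (-r)) * r ^ (-1 - α)) (Ioi 0) := by
  have hm : AEStronglyMeasurable (fun r : ℝ => (1 - Real.exp (-r)) * r ^ (-1 - α)) volume :=
    (by fun_prop : Measurable fun r : ℝ => (1 - Real.exp (-r)) * r ^ (-1 - α)).aestronglyMeasurable
  rw [← Ioc_union_Ioi_eq_Ioi zero_le_one]
  refine IntegrableOn.union ?_ ?_
  · have h1 : IntegrableOn (fun r : ℝ => r ^ (-α)) (Ioc 0 1) :=
      (intervalIntegrable_iff_integrableOn_Ioc_of_le zero_le_one).1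
        (intervalIntegral.intervalIntegrable_rpow' (by linarith))
    refine Integrable.mono' h1 hm.restrict ?_
    filter_upwards [ae_restrict_mem measurableSet_Ioc] with r hr
    have hp : 0 ≤ r ^ (-1 - α) := Real.rpow_nonneg hr.1.le _
    have h2 : 0 ≤ 1 - Real.exp (-r) := by
      have := Real.exp_le_one_iff.2 (by linarith [hr.1] : -r ≤ 0); linarith
    rw [Real.norm_eq_abs, abs_of_nonneg (mul_nonneg h2 hp)]
    calc (1 - Real.exp (-r)) * r ^ (-1 - α) ≤ r * r ^ (-1 - α) := by
          gcongr; linarith [Real.add_one_le_exp (-r)]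
      _ = r ^ (-α) := by
          rw [← Real.rpow_one_add' hr.1.le (by linarith)]; congr 1; ring
  · have h1 : IntegrableOn (fun r : ℝ => r ^ (-1 - α)) (Ioi 1) :=
      integrableOn_Ioi_rpow_of_lt (by linarith) one_pos
    refine Integrable.mono' h1 hm.restrict ?_
    filter_upwards [ae_restrict_mem measurableSet_Ioi] with r hr
    have hr0 : (0 : ℝ) < r := one_pos.trans hr
    have hp : 0 ≤ r ^ (-1 - α) := Real.rpow_nonneg hr0.le _
    have h2 : 0 ≤ 1 - Real.exp (-r) := by
      have := Real.exp_le_one_iff.2 (by linarith : -r ≤ 0); linarith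
    rw [Real.norm_eq_abs, abs_of_nonneg (mul_nonneg h2 hp)]
    calc (1 - Real.exp (-r)) * r ^ (-1 - α) ≤ 1 * r ^ (-1 - α) := by
          gcongr; linarith [Real.exp_pos (-r)]
      _ = _ := one_mul _

lemma one_sub_exp_neg_mul_rpow_comp_mul {α l r : ℝ} (hl : 0 < l) (hr : 0 < r) :
    (1 - Real.exp (-r * l)) * r ^ (-1 - α)
      = l ^ (1 + α) * ((1 - Real.exp (-(l * r))) * (l * r) ^ (-1 - α)) := by
  rw [Real.mul_rpow hl.le hr.le, show -(l * r) = -r * l by ring]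
  have : l ^ (1 + α) * l ^ (-1 - α) = 1 := by
    rw [← Real.rpow_add hl]; simp
  linear_combination (-(1 - Real.exp (-r * l)) * r ^ (-1 - α)) * this

lemma integrableOn_levy {α : ℝ} (hα0 : 0 < α) (hα1 : α < 1) {l : ℝ} (hl : 0 ≤ l) :
    IntegrableOn (fun r : ℝ => (1 - Real.exp (-r * l)) * r ^ (-1 - α)) (Ioi 0) := by
  rcases hl.eq_or_lt with rfl | hl
  · simp
  have h := (integrableOn_Ioi_comp_mul_left_iff
    (fun r : ℝ => (1 - Real.exp (-r)) * r ^ (-1 - α)) 0 hl).2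
    (by simpa using integrableOn_one_sub_exp_neg_mul_rpow hα0 hα1)
  refine IntegrableOn.congr_fun (h.const_mul (l ^ (1 + α))) (fun r hr => ?_) measurableSet_Ioi
  exact (one_sub_exp_neg_mul_rpow_comp_mul hl hr).symm

/-- The substitution `r ↦ l r` gives the scaling. With `l = ‖ξ‖²` and `α = θ/2` this represents
`‖ξ‖^θ`, up to a positive constant, as an integral of `1 - exp(-r‖ξ‖²)`. -/
lemma integral_levy {α : ℝ} (hα0 : 0 < α) {l : ℝ} (hl : 0 ≤ l) :
    ∫ r in Ioi (0 : ℝ), (1 - Real.exp (-r * l)) * r ^ (-1 - α)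
      = l ^ α * ∫ r in Ioi (0 : ℝ), (1 - Real.exp (-r)) * r ^ (-1 - α) := by
  rcases hl.eq_or_lt with rfl | hl
  · simp [Real.zero_rpow hα0.ne']
  rw [setIntegral_congr_fun measurableSet_Ioi
    (fun r hr => one_sub_exp_neg_mul_rpow_comp_mul hl hr), integral_const_mul,
    integral_comp_mul_left_Ioi (fun r : ℝ => (1 - Real.exp (-r)) * r ^ (-1 - α)) 0 hl, mul_zero,
    smul_eq_mul, ← mul_assoc]
  congr 1
  rw [← Real.rpow_neg_one, ← Real.rpow_add hl]
  congr 1; ring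

lemma integral_levy_one_pos {α : ℝ} (hα0 : 0 < α) (hα1 : α < 1) :
    0 < ∫ r in Ioi (0 : ℝ), (1 - Real.exp (-r)) * r ^ (-1 - α) := by
  have hpos : ∀ r ∈ Ioi (0 : ℝ), 0 < (1 - Real.exp (-r)) * r ^ (-1 - α) := fun r hr => by
    have h1 : Real.exp (-r) < 1 := Real.exp_lt_one_iff.mpr (by simpa using hr)
    exact mul_pos (by linarith) (Real.rpow_pos_of_pos hr _)
  rw [setIntegral_pos_iff_support_of_nonneg_ae
    (ae_restrict_of_forall_mem measurableSet_Ioi fun r hr => (hpos r hr).le)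
    (integrableOn_one_sub_exp_neg_mul_rpow hα0 hα1)]
  have : Function.support (fun r : ℝ => (1 - Real.exp (-r)) * r ^ (-1 - α)) ∩ Ioi 0 = Ioi 0 :=
    inter_eq_right.2 fun r hr => (hpos r hr).ne'
  rw [this]; simp

section Symbol

variable {V : Type*} [NormedAddCommGroup V]

/-- The symbol `exp(-t(2π|ξ|)^θ)` of the fractional heat semigroup. -/
def symb (θ t : ℝ) (ξ : V) : ℝ := Real.exp (-t * (2 * π * ‖ξ‖) ^ θ)

lemma symb_pos (θ t : ℝ) (ξ : V) : 0 < symb θ t ξ := Real.exp_pos _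

lemma symb_le_one {θ t : ℝ} (ht : 0 ≤ t) (ξ : V) : symb θ t ξ ≤ 1 := by
  rw [symb, Real.exp_le_one_iff]
  have : 0 ≤ (2 * π * ‖ξ‖) ^ θ := by positivity
  nlinarith

lemma symb_add (θ s t : ℝ) (ξ : V) : symb θ (s + t) ξ = symb θ s ξ * symb θ t ξ := by
  rw [symb, symb, symb, ← Real.exp_add]; congr 1; ring

lemma symb_eq (θ t : ℝ) (ξ : V) :
    symb θ t ξ = Real.exp (-((t * (2 * π) ^ θ) * ‖ξ‖ ^ θ)) := by
  rw [symb, Real.mul_rpow (by positivity) (norm_nonneg _)]; congr 1; ring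

lemma symb_zero {θ : ℝ} (hθ : 0 < θ) (t : ℝ) : symb θ t (0 : V) = 1 := by
  simp [symb, Real.zero_rpow hθ.ne']

lemma continuous_symb {θ : ℝ} (hθ : 0 < θ) (t : ℝ) : Continuous (symb θ t : V → ℝ) := by
  unfold symb
  have : Continuous fun ξ : V => (2 * π * ‖ξ‖) ^ θ :=
    Continuous.rpow_const (by fun_prop) fun _ => Or.inr hθ.le
  fun_prop

end Symbol

variable {V : Type*} [NormedAddCommGroup V] [InnerProductSpace ℝ V] [FiniteDimensional ℝ V]
  [MeasurableSpace V] [BorelSpace V]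

/-- Away from `r = 0` the Lévy measure is finite, so the exponent splits into a constant plus a
mixture `g` of Gaussians (the compound Poisson case). Multiplication by `g` preserves the class by
`mul_gauss` and `mixture`, hence so does passing to `exp g`. -/
lemma radialPosDef_exp_truncated_levy {α : ℝ} (hα0 : 0 < α) {c ε : ℝ} (hc : 0 ≤ c)
    (hε : 0 < ε) : RadialPosDef (fun ξ : V => Real.exp
      (-(c * ∫ r in Ioi ε, (1 - Real.exp (-r * ‖ξ‖ ^ 2)) * r ^ (-1 - α)))) := by
  have hint : IntegrableOn (fun r : ℝ => r ^ (-1 - α)) (Ioi ε) :=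
    integrableOn_Ioi_rpow_of_lt (by linarith) hε
  -- The absolute value changes nothing on the domain of integration; it makes the density
  -- nonnegative for every real `r`, as `mixture` requires.
  set ρ : ℝ → ℝ := fun r => c * |r| ^ (-1 - α) with hρ
  have hρi : Integrable ρ (volume.restrict (Ioi ε)) := by
    refine IntegrableOn.congr_fun (hint.const_mul c) (fun r hr => ?_) measurableSet_Ioi
    simp only [hρ, abs_of_pos (hε.trans hr)]
  have hρ0 : ∀ r, 0 ≤ ρ r := fun r => mul_nonneg hc (Real.rpow_nonneg (abs_nonneg _) _)
  set g : V → ℝ := fun ξ => ∫ r in Ioi ε, ρ r * Real.exp (-|r| * ‖ξ‖ ^ 2) with hg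
  have hb : ∀ (r : ℝ) (ξ : V), Real.exp (-|r| * ‖ξ‖ ^ 2) ≤ 1 := fun r ξ => by
    rw [Real.exp_le_one_iff]; nlinarith [mul_nonneg (abs_nonneg r) (sq_nonneg ‖ξ‖)]
  have hgi : ∀ ξ : V, Integrable (fun r => ρ r * Real.exp (-|r| * ‖ξ‖ ^ 2))
      (volume.restrict (Ioi ε)) := fun ξ => by
    refine hρi.mul_bdd (c := 1) (by fun_prop) (Eventually.of_forall fun r => ?_)
    rw [Real.norm_eq_abs, abs_of_pos (Real.exp_pos _)]
    exact hb r ξ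
  have hgb : ∀ ξ, |g ξ| ≤ ∫ r in Ioi ε, ρ r := fun ξ => by
    rw [← Real.norm_eq_abs]
    refine norm_integral_le_of_norm_le hρi (Eventually.of_forall fun r => ?_)
    rw [Real.norm_eq_abs, abs_of_nonneg (mul_nonneg (hρ0 r) (Real.exp_pos _).le)]
    exact mul_le_of_le_one_right (hρ0 r) (hb r ξ)
  have hmult : ∀ f : V → ℝ, RadialPosDef f → RadialPosDef (fun ξ => f ξ * g ξ) := by
    intro f hf
    obtain ⟨C, hC⟩ := hf.bdd
    have h := RadialPosDef.mixture (f := fun r ξ => f ξ * Real.exp (-|r| * ‖ξ‖ ^ 2)) hρi hρ0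
      (C := C) ?_ ?_ (fun r => hf.mul_gauss (abs_nonneg r))
    · have he : (fun ξ => f ξ * g ξ) = fun ξ =>
          ∫ r in Ioi ε, ρ r * (f ξ * Real.exp (-|r| * ‖ξ‖ ^ 2)) := by
        funext ξ
        rw [hg, ← integral_const_mul]
        refine integral_congr_ae (Eventually.of_forall fun r => ?_)
        simp only; ring
      rw [he]; exact h
    · have := hf.meas
      simp only [Function.uncurry_def]
      fun_prop
    · intro r ξ
      rw [abs_mul, abs_of_pos (Real.exp_pos _)]
      exact (mul_le_of_le_one_right (abs_nonneg _) (hb r ξ)).trans (hC ξ)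
  have hfin := (RadialPosDef.exp_of_multiplier hgb hmult).const_mul
    (Real.exp_pos (-∫ r in Ioi ε, ρ r)).le
  have he : (fun ξ : V => Real.exp
      (-(c * ∫ r in Ioi ε, (1 - Real.exp (-r * ‖ξ‖ ^ 2)) * r ^ (-1 - α))))
      = fun ξ => Real.exp (-∫ r in Ioi ε, ρ r) * Real.exp (g ξ) := by
    funext ξ
    rw [← Real.exp_add]
    congr 1
    have h1 : (∫ r in Ioi ε, ρ r) - g ξ
        = c * ∫ r in Ioi ε, (1 - Real.exp (-r * ‖ξ‖ ^ 2)) * r ^ (-1 - α) := by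
      rw [hg, ← integral_sub hρi (hgi ξ), ← integral_const_mul]
      refine setIntegral_congr_fun measurableSet_Ioi fun r hr => ?_
      simp only [hρ, abs_of_pos (hε.trans hr)]
      ring
    rw [← h1]
    ring
  rw [he]; exact hfin

/-- For `θ = 2` the function is itself a Gaussian, and the Lévy integral would diverge. For `θ < 2`
the truncation at `1/(n+1)` is removed in the limit; dividing by `κ` normalizes the Lévy constant.
-/
lemma radialPosDef_exp_neg_mul_norm_rpow {θ : ℝ} (hθ0 : 0 < θ) (hθ2 : θ ≤ 2) {t : ℝ} (ht : 0 ≤ t) :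
    RadialPosDef (fun ξ : V => Real.exp (-(t * ‖ξ‖ ^ θ))) := by
  rcases hθ2.eq_or_lt with rfl | hθ2
  · have := (RadialPosDef.one (V := V)).mul_gauss ht
    simpa using this
  have hα0 : 0 < θ / 2 := by linarith
  have hα1 : θ / 2 < 1 := by linarith
  set κ := ∫ r in Ioi (0 : ℝ), (1 - Real.exp (-r)) * r ^ (-1 - θ / 2) with hκ
  have hκ0 : 0 < κ := integral_levy_one_pos hα0 hα1
  have hnn : ∀ (ξ : V) (n : ℕ), ∀ r ∈ Ioi (1 / ((n : ℝ) + 1)),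
      0 ≤ (1 - Real.exp (-r * ‖ξ‖ ^ 2)) * r ^ (-1 - θ / 2) := by
    intro ξ n r hr
    have hr0 : 0 < r := lt_trans (by positivity) hr
    have : Real.exp (-r * ‖ξ‖ ^ 2) ≤ 1 := by
      rw [Real.exp_le_one_iff]; nlinarith [mul_nonneg hr0.le (sq_nonneg ‖ξ‖)]
    exact mul_nonneg (by linarith) (Real.rpow_nonneg hr0.le _)
  refine RadialPosDef.of_tendsto (fun n : ℕ => radialPosDef_exp_truncated_levy (V := V) hα0
    (c := t / κ) (ε := 1 / ((n : ℝ) + 1)) (by positivity) (by positivity)) (C := 1) ?_ ?_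
  · intro n ξ
    rw [abs_of_pos (Real.exp_pos _), Real.exp_le_one_iff, neg_nonpos]
    exact mul_nonneg (by positivity) (setIntegral_nonneg measurableSet_Ioi (hnn ξ n))
  · intro ξ
    have hU : (⋃ n : ℕ, Ioi (1 / ((n : ℝ) + 1))) = Ioi (0 : ℝ) := by
      ext r
      simp only [mem_iUnion, mem_Ioi]
      exact ⟨fun ⟨n, hn⟩ => lt_trans (by positivity) hn, fun hr => exists_nat_one_div_lt hr⟩
    have hlim := tendsto_setIntegral_of_monotone (μ := volume)
      (s := fun n : ℕ => Ioi (1 / ((n : ℝ) + 1)))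
      (f := fun r : ℝ => (1 - Real.exp (-r * ‖ξ‖ ^ 2)) * r ^ (-1 - θ / 2))
      (fun n => measurableSet_Ioi) (fun m n hmn => Ioi_subset_Ioi
        (one_div_le_one_div_of_le (by positivity) (by gcongr)))
      (by rw [hU]; exact integrableOn_levy hα0 hα1 (sq_nonneg _))
    rw [hU, integral_levy hα0 (sq_nonneg _), ← hκ] at hlim
    have h2 := ((hlim.const_mul (t / κ)).neg).rexp
    convert h2 using 3
    rw [← Real.rpow_natCast, ← Real.rpow_mul (norm_nonneg _)]
    field_simp
    norm_num

lemma integrable_symb {θ : ℝ} (hθ : 0 < θ) {t : ℝ} (ht : 0 < t) :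
    Integrable (symb θ t : V → ℝ) := by
  rcases subsingleton_or_nontrivial V with hV | hV
  · exact (continuous_symb hθ t).integrable_of_hasCompactSupport
      (HasCompactSupport.of_compactSpace _)
  have hfun : (symb θ t : V → ℝ)
      = fun ξ => (fun y : ℝ => Real.exp (-(t * (2 * π) ^ θ) * y ^ θ)) ‖ξ‖ := by
    funext ξ; rw [symb_eq]; simp
  rw [hfun, integrable_fun_norm_addHaar volume (E := V)
    (f := fun y : ℝ => Real.exp (-(t * (2 * π) ^ θ) * y ^ θ))]
  have := integrableOn_rpow_mul_exp_neg_mul_rpow (p := θ) (s := ((Module.finrank ℝ V - 1 : ℕ) : ℝ))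
    (b := t * (2 * π) ^ θ) (lt_of_lt_of_le (by norm_num) (Nat.cast_nonneg _)) hθ (by positivity)
  simpa [Real.rpow_natCast] using this

end FracHeat

/-! ### Properties of the kernel: sign, monotonicity, scaling, mass and semigroup law. -/

namespace FracHeat

open Filter Topology Real
open scoped FourierTransform Convolution

variable {N : ℕ}

local notation "E" => EuclideanSpace ℝ (Fin N)

lemma kernel_eq_integral {θ : ℝ} (hθ : 0 < θ) {t : ℝ} (ht : 0 < t) (x : E) :
    kernel N θ x t = ∫ ξ : E, symb θ t ξ * Real.cos (2 * π * inner ℝ ξ x) :=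
  (integral_mul_cos_eq_re_fourierInv (integrable_symb hθ ht) x).symm

lemma integrable_symb_mul_cos {θ : ℝ} (hθ : 0 < θ) {t : ℝ} (ht : 0 < t) (x : E) :
    Integrable (fun ξ : E => symb θ t ξ * Real.cos (2 * π * inner ℝ ξ x)) := by
  refine (integrable_symb hθ ht).mul_bdd (c := 1) ?_
    (Eventually.of_forall fun ξ => Real.abs_cos_le_one _)
  exact (by fun_prop : Continuous fun ξ : E => Real.cos (2 * π * inner ℝ ξ x)).aestronglyMeasurable

/-- Removing the regularization transfers sign and radial monotonicity to the kernel; the integrable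
symbol dominates. -/
lemma tendsto_gaussCos_symb {θ : ℝ} (hθ : 0 < θ) {t : ℝ} (ht : 0 < t) (x : E) :
    Tendsto (fun n : ℕ => gaussCos (symb θ t) (1 / ((n : ℝ) + 1)) x) atTop
      (𝓝 (kernel N θ x t)) := by
  rw [kernel_eq_integral hθ ht]
  refine tendsto_integral_of_dominated_convergence (fun ξ => symb θ t ξ) (fun n => ?_)
    (integrable_symb hθ ht) (fun n => Eventually.of_forall fun ξ => ?_)
    (Eventually.of_forall fun ξ => ?_)
  · have := continuous_symb (V := E) hθ t
    exact Continuous.aestronglyMeasurable (by fun_prop)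
  · rw [Real.norm_eq_abs, abs_mul, abs_mul, abs_of_pos (symb_pos _ _ _), abs_of_pos (Real.exp_pos _)]
    refine mul_le_of_le_one_right (symb_pos _ _ _).le
      (mul_le_one₀ ?_ (abs_nonneg _) (Real.abs_cos_le_one _))
    rw [Real.exp_le_one_iff, neg_mul, neg_nonpos]
    positivity
  · have h0 := tendsto_one_div_add_atTop_nhds_zero_nat (𝕜 := ℝ)
    have h1 := ((h0.neg.mul_const (‖ξ‖ ^ 2)).rexp.mul_const
      (Real.cos (2 * π * inner ℝ ξ x))).const_mul (symb θ t ξ)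
    simpa using h1

lemma radialPosDef_symb {θ : ℝ} (hθ₀ : 0 < θ) (hθ₂ : θ ≤ 2) {t : ℝ} (ht : 0 ≤ t) :
    RadialPosDef (symb θ t : E → ℝ) := by
  have : (symb θ t : E → ℝ) = fun ξ => Real.exp (-((t * (2 * π) ^ θ) * ‖ξ‖ ^ θ)) :=
    funext fun ξ => symb_eq θ t ξ
  rw [this]
  exact radialPosDef_exp_neg_mul_norm_rpow hθ₀ hθ₂ (by positivity)

lemma kernel_nonneg {θ : ℝ} (hθ₀ : 0 < θ) (hθ₂ : θ ≤ 2) {t : ℝ} (ht : 0 < t) (x : E) :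
    0 ≤ kernel N θ x t :=
  ge_of_tendsto' (tendsto_gaussCos_symb hθ₀ ht x) fun n =>
    (radialPosDef_symb hθ₀ hθ₂ ht.le).nonneg _ (by positivity) x

lemma kernel_anti {θ : ℝ} (hθ₀ : 0 < θ) (hθ₂ : θ ≤ 2) {t : ℝ} (ht : 0 < t) {x y : E}
    (hxy : ‖x‖ ≤ ‖y‖) : kernel N θ y t ≤ kernel N θ x t :=
  le_of_tendsto_of_tendsto' (tendsto_gaussCos_symb hθ₀ ht y) (tendsto_gaussCos_symb hθ₀ ht x)
    fun n => (radialPosDef_symb hθ₀ hθ₂ ht.le).anti _ (by positivity) x y hxy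

lemma kernel_zero_eq {θ : ℝ} (hθ : 0 < θ) {t : ℝ} (ht : 0 < t) :
    kernel N θ 0 t = t ^ (-((N : ℝ) / θ)) * kernel N θ 0 1 := by
  rw [kernel_eq_integral hθ ht, kernel_eq_integral hθ one_pos]
  simp only [inner_zero_right, mul_zero, Real.cos_zero, mul_one]
  have h : ∀ ξ : E, symb θ t ξ = symb θ 1 (t ^ (1 / θ) • ξ) := by
    intro ξ
    have h1 : (t ^ (1 / θ)) ^ θ = t := by
      rw [← Real.rpow_mul ht.le, one_div_mul_cancel hθ.ne', Real.rpow_one]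
    rw [symb_eq, symb_eq, norm_smul, Real.norm_of_nonneg (by positivity),
      Real.mul_rpow (by positivity) (norm_nonneg _), h1]
    congr 1; ring
  simp only [h]
  rw [Measure.integral_comp_smul_of_nonneg volume (symb θ 1) (t ^ (1 / θ)) (hR := by positivity),
    smul_eq_mul, finrank_euclideanSpace_fin]
  congr 1
  rw [← Real.rpow_natCast, ← Real.rpow_mul ht.le, ← Real.rpow_neg ht.le]
  congr 1; ring

lemma fourierInv_symb_neg {θ : ℝ} (t : ℝ) (x : E) :
    𝓕⁻ (fun ξ : E => ((symb θ t ξ : ℝ) : ℂ)) (-x) = 𝓕⁻ (fun ξ : E => ((symb θ t ξ : ℝ) : ℂ)) x := by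
  rw [Real.fourierInv_eq_fourier_neg, neg_neg, Real.fourierInv_eq_fourier_comp_neg]
  simp only [symb, norm_neg]

/-- The kernel is defined as a real part, so nothing may be lost: the imaginary part is a sine
transform, odd in `x`, while the transform of the even symbol is even. -/
lemma fourierInv_symb_eq {θ : ℝ} (hθ : 0 < θ) {t : ℝ} (ht : 0 < t) (x : E) :
    𝓕⁻ (fun ξ : E => ((symb θ t ξ : ℝ) : ℂ)) x = ((kernel N θ x t : ℝ) : ℂ) := by
  refine Complex.ext (by rw [Complex.ofReal_re]; rfl) ?_
  rw [Complex.ofReal_im]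
  have him : ∀ x : E, (𝓕⁻ (fun ξ : E => ((symb θ t ξ : ℝ) : ℂ)) x).im
      = ∫ ξ : E, symb θ t ξ * Real.sin (2 * π * inner ℝ ξ x) := by
    intro x
    rw [Real.fourierInv_eq']
    have hi : Integrable (fun ξ : E =>
        Complex.exp (((2 * π * inner ℝ ξ x : ℝ) : ℂ) * Complex.I) • ((symb θ t ξ : ℝ) : ℂ)) := by
      refine ((integrable_symb hθ ht).ofReal (𝕜 := ℂ)).bdd_mul (c := 1) ?_ ?_
      · exact (by fun_prop : Continuous fun ξ : E =>
          Complex.exp (((2 * π * inner ℝ ξ x : ℝ) : ℂ) * Complex.I)).aestronglyMeasurable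
      · exact Eventually.of_forall fun ξ => (Complex.norm_exp_ofReal_mul_I _).le
    have := integral_im hi
    simp only [RCLike.im_to_complex] at this
    rw [← this]
    refine integral_congr_ae (Eventually.of_forall fun ξ => ?_)
    simp only [smul_eq_mul, Complex.im_mul_ofReal, Complex.exp_ofReal_mul_I_im]
    ring
  have h1 := congrArg Complex.im (fourierInv_symb_neg (θ := θ) t x)
  rw [him, him] at h1
  rw [him]
  simp only [inner_neg_right, mul_neg, Real.sin_neg, integral_neg] at h1
  linarith

lemma fourier_symb_eq {θ : ℝ} (hθ : 0 < θ) {t : ℝ} (ht : 0 < t) (x : E) :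
    𝓕 (fun ξ : E => ((symb θ t ξ : ℝ) : ℂ)) x = ((kernel N θ x t : ℝ) : ℂ) := by
  rw [← fourierInv_symb_eq hθ ht, ← fourierInv_symb_neg, Real.fourierInv_eq_fourier_neg, neg_neg]

lemma continuous_kernel {θ : ℝ} (hθ : 0 < θ) {t : ℝ} (ht : 0 < t) :
    Continuous (fun x : E => kernel N θ x t) := by
  have : (fun x : E => kernel N θ x t)
      = fun x => ∫ ξ : E, symb θ t ξ * Real.cos (2 * π * inner ℝ ξ x) :=
    funext fun x => kernel_eq_integral hθ ht x
  rw [this]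
  refine continuous_of_dominated (bound := fun ξ => symb θ t ξ)
    (fun x => (integrable_symb_mul_cos hθ ht x).aestronglyMeasurable)
    (fun x => Eventually.of_forall fun ξ => ?_) (integrable_symb hθ ht)
    (Eventually.of_forall fun ξ => by fun_prop)
  rw [Real.norm_eq_abs, abs_mul, abs_of_pos (symb_pos _ _ _)]
  exact mul_le_of_le_one_right (symb_pos _ _ _).le (Real.abs_cos_le_one _)

lemma measurable_kernel (N : ℕ) (θ : ℝ) :
    Measurable (fun p : EuclideanSpace ℝ (Fin N) × ℝ => kernel N θ p.1 p.2) := by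
  unfold kernel
  simp only [Real.fourierInv_eq']
  refine Complex.measurable_re.comp (StronglyMeasurable.measurable ?_)
  refine StronglyMeasurable.integral_prod_right'
    (f := fun q : (EuclideanSpace ℝ (Fin N) × ℝ) × EuclideanSpace ℝ (Fin N) =>
      Complex.exp (((2 * π * inner ℝ q.2 q.1.1 : ℝ) : ℂ) * Complex.I) •
        ((Real.exp (-q.1.2 * (2 * π * ‖q.2‖) ^ θ) : ℝ) : ℂ)) ?_
  refine Measurable.stronglyMeasurable ?_
  have h1 : Measurable fun q : (EuclideanSpace ℝ (Fin N) × ℝ) × EuclideanSpace ℝ (Fin N) =>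
      (inner ℝ q.2 q.1.1 : ℝ) := (by fun_prop : Continuous _).measurable
  fun_prop

lemma integral_gaussCos_one {b : ℝ} (hb : 0 < b) :
    Integrable (fun ξ : E => gaussCos (fun _ => 1) b ξ) ∧
      ∫ ξ : E, gaussCos (fun _ => 1) b ξ = 1 := by
  have hfun : (fun ξ : E => gaussCos (fun _ => 1) b ξ) = fun ξ : E =>
      (π / b) ^ (Module.finrank ℝ E / 2 : ℝ) * Real.exp (-(π ^ 2 / b) * ‖ξ‖ ^ 2) := by
    funext ξ
    rw [gaussCos_one hb]
    congr 2; ring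
  rw [hfun]
  refine ⟨(integrable_exp_neg_mul_sq_norm (by positivity)).const_mul _, ?_⟩
  rw [integral_const_mul, GaussianFourier.integral_rexp_neg_mul_sq_norm (by positivity),
    ← Real.mul_rpow (by positivity) (by positivity)]
  have : π / b * (π / (π ^ 2 / b)) = 1 := by field_simp
  rw [this, Real.one_rpow]

/-- Fubini moves the Gaussian to the Fourier side, where it becomes a probability density integrated
against a symbol that is at most 1. -/
lemma lintegral_kernel_mul_gauss_le {θ : ℝ} (hθ₀ : 0 < θ) (hθ₂ : θ ≤ 2) {t : ℝ} (ht : 0 < t)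
    {b : ℝ} (hb : 0 < b) :
    ∫⁻ x : E, ENNReal.ofReal (kernel N θ x t * Real.exp (-b * ‖x‖ ^ 2)) ≤ 1 := by
  have hprod : Integrable (fun p : E × E => symb θ t p.2 *
      (Real.exp (-b * ‖p.1‖ ^ 2) * Real.cos (2 * π * inner ℝ p.1 p.2))) (volume.prod volume) := by
    have h := (integrable_exp_neg_mul_sq_norm (V := E) hb).mul_prod (integrable_symb (V := E) hθ₀ ht)
    refine (h.mul_bdd (c := 1) (g := fun p : E × E => Real.cos (2 * π * inner ℝ p.1 p.2))
      (Continuous.aestronglyMeasurable (by fun_prop))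
      (Eventually.of_forall fun p => Real.abs_cos_le_one _)).congr
        (Eventually.of_forall fun p => ?_)
    simp only; ring
  have heq : ∀ x : E, kernel N θ x t * Real.exp (-b * ‖x‖ ^ 2) = ∫ ξ : E, symb θ t ξ *
      (Real.exp (-b * ‖x‖ ^ 2) * Real.cos (2 * π * inner ℝ x ξ)) := by
    intro x
    rw [kernel_eq_integral hθ₀ ht, ← integral_mul_const]
    refine integral_congr_ae (Eventually.of_forall fun ξ => ?_)
    simp only [real_inner_comm]
    ring
  have hint : Integrable fun x : E => kernel N θ x t * Real.exp (-b * ‖x‖ ^ 2) :=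
    hprod.integral_prod_left.congr (Eventually.of_forall fun x => (heq x).symm)
  rw [← ofReal_integral_eq_lintegral_ofReal hint (Eventually.of_forall fun x =>
    mul_nonneg (kernel_nonneg hθ₀ hθ₂ ht x) (Real.exp_pos _).le)]
  refine ENNReal.ofReal_le_one.2 ?_
  have hswap : ∫ x : E, kernel N θ x t * Real.exp (-b * ‖x‖ ^ 2)
      = ∫ ξ : E, symb θ t ξ * gaussCos (fun _ => 1) b ξ := by
    simp only [heq]
    rw [integral_integral_swap hprod]
    refine integral_congr_ae (Eventually.of_forall fun ξ => ?_)
    simp only [gaussCos, one_mul, integral_const_mul]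
  rw [hswap]
  obtain ⟨hi, h1⟩ := integral_gaussCos_one (N := N) hb
  refine (integral_mono_of_nonneg (g := fun ξ : E => gaussCos (fun _ => 1) b ξ) (Eventually.of_forall fun ξ => ?_) hi
    (Eventually.of_forall fun ξ => ?_)).trans h1.le
  · exact mul_nonneg (symb_pos _ _ _).le (RadialPosDef.one.nonneg b hb ξ)
  · exact mul_le_of_le_one_left (RadialPosDef.one.nonneg b hb ξ) (symb_le_one ht.le ξ)

/-- Nonnegativity allows monotone convergence as the Gaussian weight tends to 1, so no decay
estimate for the kernel is needed. -/
lemma integrable_kernel {θ : ℝ} (hθ₀ : 0 < θ) (hθ₂ : θ ≤ 2) {t : ℝ} (ht : 0 < t) :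
    Integrable (fun x : E => kernel N θ x t) := by
  refine ⟨(continuous_kernel hθ₀ ht).aestronglyMeasurable, ?_⟩
  rw [hasFiniteIntegral_iff_ofReal (Eventually.of_forall fun x => kernel_nonneg hθ₀ hθ₂ ht x)]
  have hlim : Tendsto (fun n : ℕ => ∫⁻ x : E, ENNReal.ofReal
      (kernel N θ x t * Real.exp (-(1 / ((n : ℝ) + 1)) * ‖x‖ ^ 2))) atTop
      (𝓝 (∫⁻ x : E, ENNReal.ofReal (kernel N θ x t))) := by
    refine lintegral_tendsto_of_tendsto_of_monotone (fun n => ?_)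
      (Eventually.of_forall fun x m n hmn => ?_) (Eventually.of_forall fun x => ?_)
    · have := continuous_kernel (N := N) hθ₀ ht
      exact (ENNReal.continuous_ofReal.comp (by fun_prop)).measurable.aemeasurable
    · have := kernel_nonneg hθ₀ hθ₂ ht x
      have h2 : 1 / ((n : ℝ) + 1) ≤ 1 / ((m : ℝ) + 1) :=
        one_div_le_one_div_of_le (by positivity) (by gcongr)
      refine ENNReal.ofReal_le_ofReal ?_
      gcongr
    · have h0 := tendsto_one_div_add_atTop_nhds_zero_nat (𝕜 := ℝ)
      have h1 := ENNReal.tendsto_ofReal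
        ((h0.neg.mul_const (‖x‖ ^ 2)).rexp.const_mul (kernel N θ x t))
      simpa using h1
  exact (le_of_tendsto' hlim fun n =>
    lintegral_kernel_mul_gauss_le hθ₀ hθ₂ ht (by positivity)).trans_lt ENNReal.one_lt_top

lemma fourier_kernel {θ : ℝ} (hθ₀ : 0 < θ) (hθ₂ : θ ≤ 2) {t : ℝ} (ht : 0 < t) :
    𝓕 (fun x : E => ((kernel N θ x t : ℝ) : ℂ)) = fun ξ => ((symb θ t ξ : ℝ) : ℂ) := by
  have hc : Continuous fun ξ : E => ((symb θ t ξ : ℝ) : ℂ) :=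
    Complex.continuous_ofReal.comp (continuous_symb hθ₀ t)
  have hF : 𝓕 (fun ξ : E => ((symb θ t ξ : ℝ) : ℂ)) = fun x => ((kernel N θ x t : ℝ) : ℂ) :=
    funext fun x => fourier_symb_eq hθ₀ ht x
  have hFi : 𝓕⁻ (fun ξ : E => ((symb θ t ξ : ℝ) : ℂ)) = fun x => ((kernel N θ x t : ℝ) : ℂ) :=
    funext fun x => fourierInv_symb_eq hθ₀ ht x
  have h := hc.fourier_fourierInv_eq (integrable_symb hθ₀ ht).ofReal
    (by rw [hF]; exact (integrable_kernel hθ₀ hθ₂ ht).ofReal)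
  rwa [hFi] at h

lemma integral_kernel {θ : ℝ} (hθ₀ : 0 < θ) (hθ₂ : θ ≤ 2) {t : ℝ} (ht : 0 < t) :
    ∫ x : E, kernel N θ x t = 1 := by
  have h := congrFun (fourier_kernel (N := N) hθ₀ hθ₂ ht) 0
  rw [symb_zero hθ₀, Real.fourier_eq'] at h
  simp only [inner_zero_right, mul_zero, Complex.ofReal_zero, zero_mul, Complex.exp_zero,
    one_smul, Complex.ofReal_one] at h
  rw [integral_complex_ofReal] at h
  exact_mod_cast h

/-- The Fourier transform of the convolution is the product of the symbols. Continuity of the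
convolution (one factor integrable, the other bounded and continuous) makes the inversion valid at
every point. -/
lemma integral_kernel_mul_kernel {θ : ℝ} (hθ₀ : 0 < θ) (hθ₂ : θ ≤ 2) {s t : ℝ} (hs : 0 < s)
    (ht : 0 < t) (x : E) :
    ∫ y : E, kernel N θ y s * kernel N θ (x - y) t = kernel N θ x (s + t) := by
  set f : E → ℂ := fun x => ((kernel N θ x s : ℝ) : ℂ) with hf
  set g : E → ℂ := fun x => ((kernel N θ x t : ℝ) : ℂ) with hg
  have hfi : Integrable f := (integrable_kernel hθ₀ hθ₂ hs).ofReal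
  have hgi : Integrable g := (integrable_kernel hθ₀ hθ₂ ht).ofReal
  have hgc : Continuous g := Complex.continuous_ofReal.comp (continuous_kernel hθ₀ ht)
  have hcont : Continuous (f ⋆[ContinuousLinearMap.mul ℂ ℂ] g) := by
    refine BddAbove.continuous_convolution_right_of_integrable _
      ⟨kernel N θ 0 t, ?_⟩ hfi hgc
    rintro _ ⟨y, rfl⟩
    simp only [hg, Complex.norm_real, Real.norm_eq_abs]
    rw [abs_of_nonneg (kernel_nonneg hθ₀ hθ₂ ht y)]
    exact kernel_anti hθ₀ hθ₂ ht (by simp)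
  have hF : 𝓕 (f ⋆[ContinuousLinearMap.mul ℂ ℂ] g) = fun ξ => ((symb θ (s + t) ξ : ℝ) : ℂ) := by
    funext ξ
    rw [Real.fourier_mul_convolution_eq hfi hgi, hf, hg, fourier_kernel hθ₀ hθ₂ hs,
      fourier_kernel hθ₀ hθ₂ ht, symb_add, Complex.ofReal_mul]
  have h := hcont.fourierInv_fourier_eq (hfi.integrable_convolution _ hgi)
    (by rw [hF]; exact (integrable_symb hθ₀ (add_pos hs ht)).ofReal)
  rw [hF] at h
  have h2 := congrFun h x
  rw [fourierInv_symb_eq hθ₀ (add_pos hs ht)] at h2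
  have h3 : (f ⋆[ContinuousLinearMap.mul ℂ ℂ] g) x
      = ((∫ y : E, kernel N θ y s * kernel N θ (x - y) t : ℝ) : ℂ) := by
    rw [convolution_def, ← integral_complex_ofReal]
    simp [hf, hg]
  rw [h3] at h2
  exact_mod_cast h2.symm

end FracHeat

/-! ### The semigroup on measures and its bound by `t^(-N/θ)`. -/

namespace FracHeat

open Filter Topology Real

variable {N : ℕ}

local notation "E" => EuclideanSpace ℝ (Fin N)

/-- The kernel as a function with values in `[0,∞]`. -/
@[irreducible] def ekernel (θ : ℝ) (x : E) (t : ℝ) : ℝ≥0∞ := ENNReal.ofReal (kernel N θ x t)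

lemma measurable_ekernel (θ : ℝ) : Measurable (fun p : E × ℝ => ekernel θ p.1 p.2) := by
  simp only [ekernel]
  exact (measurable_kernel N θ).ennreal_ofReal

@[fun_prop]
lemma measurable_ekernel_comp {α : Type*} [MeasurableSpace α] (θ : ℝ) {f : α → E} {g : α → ℝ}
    (hf : Measurable f) (hg : Measurable g) : Measurable fun a => ekernel θ (f a) (g a) :=
  (measurable_ekernel θ).comp (hf.prodMk hg)

lemma semigroup_eq (θ t : ℝ) (μ : Measure E) (x : E) :
    semigroup θ t μ x = ∫⁻ y, ekernel θ (x - y) t ∂μ := by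
  simp only [semigroup, ekernel]

lemma ekernel_anti {θ : ℝ} (hθ₀ : 0 < θ) (hθ₂ : θ ≤ 2) {t : ℝ} (ht : 0 < t) {x y : E}
    (hxy : ‖x‖ ≤ ‖y‖) : ekernel θ y t ≤ ekernel θ x t := by
  simp only [ekernel]
  exact ENNReal.ofReal_le_ofReal (kernel_anti hθ₀ hθ₂ ht hxy)

lemma lintegral_ekernel {θ : ℝ} (hθ₀ : 0 < θ) (hθ₂ : θ ≤ 2) {t : ℝ} (ht : 0 < t) :
    ∫⁻ y : E, ekernel θ y t = 1 := by
  simp only [ekernel]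
  rw [← ofReal_integral_eq_lintegral_ofReal (integrable_kernel hθ₀ hθ₂ ht)
    (Eventually.of_forall fun x => kernel_nonneg hθ₀ hθ₂ ht x), integral_kernel hθ₀ hθ₂ ht,
    ENNReal.ofReal_one]

lemma lintegral_ekernel_sub {θ : ℝ} (hθ₀ : 0 < θ) (hθ₂ : θ ≤ 2) {t : ℝ} (ht : 0 < t) (x : E) :
    ∫⁻ y : E, ekernel θ (x - y) t = 1 := by
  rw [lintegral_sub_left_eq_self (fun y : E => ekernel θ y t), lintegral_ekernel hθ₀ hθ₂ ht]

lemma lintegral_ekernel_mul_ekernel {θ : ℝ} (hθ₀ : 0 < θ) (hθ₂ : θ ≤ 2) {s t : ℝ} (hs : 0 < s)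
    (ht : 0 < t) (x z : E) :
    ∫⁻ y : E, ekernel θ (x - y) t * ekernel θ (y - z) s = ekernel θ (x - z) (t + s) := by
  have h1 : ∫⁻ y : E, ekernel θ (x - y) t * ekernel θ (y - z) s
      = ∫⁻ y : E, ekernel θ ((x - z) - y) t * ekernel θ y s := by
    rw [← lintegral_sub_right_eq_self (fun y : E => ekernel θ ((x - z) - y) t * ekernel θ y s) z]
    refine lintegral_congr fun y => ?_
    rw [sub_sub_sub_cancel_right]
  have h2 : ∀ y : E, ekernel θ ((x - z) - y) t * ekernel θ y s
      = ENNReal.ofReal (kernel N θ y s * kernel N θ ((x - z) - y) t) := fun y => by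
    rw [ENNReal.ofReal_mul (kernel_nonneg hθ₀ hθ₂ hs y), mul_comm, ekernel, ekernel]
  rw [h1]
  simp only [h2]
  rw [← ofReal_integral_eq_lintegral_ofReal, integral_kernel_mul_kernel hθ₀ hθ₂ hs ht,
    add_comm, ekernel]
  · refine ((integrable_kernel hθ₀ hθ₂ hs).mul_bdd (c := kernel N θ 0 t)
      (((continuous_kernel hθ₀ ht).comp (continuous_const.sub continuous_id)).aestronglyMeasurable)
      (Eventually.of_forall fun y => ?_))
    simp only [Real.norm_eq_abs]
    rw [abs_of_nonneg (kernel_nonneg hθ₀ hθ₂ ht _)]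
    exact kernel_anti hθ₀ hθ₂ ht (by simp)
  · exact Eventually.of_forall fun y =>
      mul_nonneg (kernel_nonneg hθ₀ hθ₂ hs y) (kernel_nonneg hθ₀ hθ₂ ht _)

lemma lintegral_ekernel_mul_lintegral {θ : ℝ} (hθ₀ : 0 < θ) (hθ₂ : θ ≤ 2) {s t : ℝ} (hs : 0 < s)
    (ht : 0 < t) (μ : Measure E) [SFinite μ] {f : E → ℝ≥0∞} (hf : Measurable f) (x : E) :
    ∫⁻ y : E, ekernel θ (x - y) t * ∫⁻ z, ekernel θ (y - z) s * f z ∂μ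
      = ∫⁻ z, ekernel θ (x - z) (t + s) * f z ∂μ := by
  have h1 : ∀ y : E, ekernel θ (x - y) t * ∫⁻ z, ekernel θ (y - z) s * f z ∂μ
      = ∫⁻ z, ekernel θ (x - y) t * (ekernel θ (y - z) s * f z) ∂μ := fun y => by
    rw [lintegral_const_mul]
    fun_prop
  simp only [h1]
  rw [lintegral_lintegral_swap]
  · refine lintegral_congr fun z => ?_
    simp only [← mul_assoc]
    rw [lintegral_mul_const, lintegral_ekernel_mul_ekernel hθ₀ hθ₂ hs ht]
    fun_prop
  · refine Measurable.aemeasurable ?_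
    fun_prop

lemma lintegral_ekernel_mul_semigroup {θ : ℝ} (hθ₀ : 0 < θ) (hθ₂ : θ ≤ 2) {s t : ℝ} (hs : 0 < s)
    (ht : 0 < t) (μ : Measure E) [SFinite μ] (x : E) :
    ∫⁻ y : E, ekernel θ (x - y) t * semigroup θ s μ y = semigroup θ (t + s) μ x := by
  simpa [semigroup_eq] using lintegral_ekernel_mul_lintegral hθ₀ hθ₂ hs ht μ
    (f := fun _ => 1) measurable_const x

lemma measurable_semigroup (θ : ℝ) (μ : Measure E) [SFinite μ] :
    Measurable (fun p : E × ℝ => semigroup θ p.2 μ p.1) := by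
  simp only [semigroup_eq]
  refine Measurable.lintegral_prod_right' (f := fun q : (E × ℝ) × E => ekernel θ (q.1.1 - q.2) q.1.2) ?_
  fun_prop

/-- The centre `w` is `z` moved by 1/2 towards the origin. The ball of radius 1/2 about `w` lies in
the unit ball about `z` and contains only points of norm below `‖z‖`, where the kernel is at least
its value at `z`. -/
lemma ekernel_mul_volume_ball_le {θ : ℝ} (hθ₀ : 0 < θ) (hθ₂ : θ ≤ 2) {t : ℝ} (ht : 0 < t)
    {z : E} (hz : 1 ≤ ‖z‖) :
    ekernel θ z t * volume (Metric.ball (0 : E) (1 / 2))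
      ≤ ∫⁻ v in Metric.ball z 1, ekernel θ v t := by
  have hz0 : 0 < ‖z‖ := by linarith
  set w : E := (1 - 1 / (2 * ‖z‖)) • z with hw
  have hc : 0 ≤ 1 - 1 / (2 * ‖z‖) := by
    rw [sub_nonneg, div_le_one (by positivity)]; linarith
  have hwn : ‖w‖ = ‖z‖ - 1 / 2 := by
    rw [hw, norm_smul, Real.norm_of_nonneg hc]; field_simp
  have hwz : dist w z = 1 / 2 := by
    have : w - z = (-(1 / (2 * ‖z‖))) • z := by rw [hw, sub_smul, one_smul, neg_smul]; abel
    rw [dist_eq_norm, this, norm_smul, norm_neg, Real.norm_of_nonneg (by positivity)]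
    field_simp
  have hvol : volume (Metric.ball (0 : E) (1 / 2)) = volume (Metric.ball w (1 / 2)) := by
    rw [Measure.addHaar_ball_center volume w]
  calc ekernel θ z t * volume (Metric.ball (0 : E) (1 / 2))
      = ∫⁻ _ in Metric.ball w (1 / 2), ekernel θ z t := by rw [setLIntegral_const, hvol]
    _ ≤ ∫⁻ v in Metric.ball w (1 / 2), ekernel θ v t := by
        refine setLIntegral_mono' measurableSet_ball fun v hv => ?_
        refine ekernel_anti hθ₀ hθ₂ ht ?_
        rw [Metric.mem_ball, dist_eq_norm] at hv
        have := norm_le_norm_add_norm_sub' v w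
        linarith
    _ ≤ ∫⁻ v in Metric.ball z 1, ekernel θ v t := by
        refine lintegral_mono_set (Metric.ball_subset_ball' ?_)
        rw [hwz]; norm_num

/-- Near the diagonal the kernel is bounded by its maximum, elsewhere by a local average. The
average is written with balls in the variable `y`, so that integrating in `μ` produces masses of
unit balls. -/
lemma ekernel_sub_le {θ : ℝ} (hθ₀ : 0 < θ) (hθ₂ : θ ≤ 2) {t : ℝ} (ht : 0 < t) (x y : E) :
    ekernel θ (x - y) t
      ≤ (Metric.ball x 1).indicator (fun _ => ekernel θ (0 : E) t) y
        + (volume (Metric.ball (0 : E) (1 / 2)))⁻¹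
          * ∫⁻ v : E, (Metric.ball (x - v) 1).indicator (fun _ => ekernel θ v t) y := by
  have hβ0 : volume (Metric.ball (0 : E) (1 / 2)) ≠ 0 :=
    (Metric.measure_ball_pos volume 0 (by norm_num)).ne'
  have hβt : volume (Metric.ball (0 : E) (1 / 2)) ≠ ∞ := measure_ball_lt_top.ne
  by_cases hy : y ∈ Metric.ball x 1
  · rw [indicator_of_mem hy]
    exact le_add_right (ekernel_anti hθ₀ hθ₂ ht (by simp))
  · refine le_add_left ?_
    have hz : 1 ≤ ‖x - y‖ := by
      rw [Metric.mem_ball, dist_comm, dist_eq_norm, not_lt] at hy; exact hy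
    have h := ekernel_mul_volume_ball_le hθ₀ hθ₂ ht hz
    rw [← lintegral_indicator measurableSet_ball] at h
    have h2 : ∀ v : E, (Metric.ball (x - y) 1).indicator (fun v => ekernel θ v t) v
        = (Metric.ball (x - v) 1).indicator (fun _ => ekernel θ v t) y := by
      intro v
      have : v ∈ Metric.ball (x - y) 1 ↔ y ∈ Metric.ball (x - v) 1 := by
        rw [Metric.mem_ball, Metric.mem_ball, dist_eq_norm, dist_eq_norm]
        rw [show v - (x - y) = y - (x - v) by abel]
      by_cases hv : v ∈ Metric.ball (x - y) 1
      · rw [indicator_of_mem hv, indicator_of_mem (this.1 hv)]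
      · rw [indicator_of_notMem hv, indicator_of_notMem (fun h => hv (this.2 h))]
    simp only [h2] at h
    rw [mul_comm, ← div_eq_mul_inv, ENNReal.le_div_iff_mul_le (Or.inl hβ0) (Or.inl hβt)]
    exact h

lemma measurable_indicator_ball_ekernel (θ t : ℝ) (x : E) : Measurable fun p : E × E =>
    (Metric.ball (x - p.2) 1).indicator (fun _ => ekernel θ p.2 t) p.1 := by
  have hS : MeasurableSet {p : E × E | dist p.1 (x - p.2) < 1} :=
    measurableSet_lt (by fun_prop) measurable_const
  exact (by fun_prop : Measurable fun p : E × E => ekernel θ p.2 t).indicator hS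

lemma lintegral_lintegral_indicator_ball_le {θ : ℝ} (hθ₀ : 0 < θ) (hθ₂ : θ ≤ 2) {t : ℝ}
    (ht : 0 < t) (μ : Measure E) [SFinite μ] {A : ℝ≥0∞} (hA : ∀ x : E, μ (Metric.ball x 1) ≤ A)
    (x : E) :
    ∫⁻ y, (∫⁻ v : E, (Metric.ball (x - v) 1).indicator (fun _ => ekernel θ v t) y) ∂μ ≤ A := by
  have hm := measurable_indicator_ball_ekernel θ t x
  rw [lintegral_lintegral_swap hm.aemeasurable]
  calc ∫⁻ v : E, ∫⁻ y, (Metric.ball (x - v) 1).indicator (fun _ => ekernel θ v t) y ∂μ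
      ≤ ∫⁻ v : E, ekernel θ v t * A := by
        refine lintegral_mono fun v => ?_
        rw [lintegral_indicator_const measurableSet_ball]
        gcongr
        exact hA _
    _ = A := by
        rw [lintegral_mul_const _ (by fun_prop), lintegral_ekernel hθ₀ hθ₂ ht, one_mul]

lemma semigroup_le {θ : ℝ} (hθ₀ : 0 < θ) (hθ₂ : θ ≤ 2) {t : ℝ} (ht : 0 < t)
    (μ : Measure E) [SFinite μ] {A : ℝ≥0∞} (hA : ∀ x : E, μ (Metric.ball x 1) ≤ A) (x : E) :
    semigroup θ t μ x
      ≤ ekernel θ (0 : E) t * A + (volume (Metric.ball (0 : E) (1 / 2)))⁻¹ * A := by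
  have hm := (measurable_indicator_ball_ekernel θ t x).lintegral_prod_right'
    (ν := (volume : Measure E))
  rw [semigroup_eq]
  refine (lintegral_mono (ekernel_sub_le hθ₀ hθ₂ ht x)).trans ?_
  rw [lintegral_add_left (measurable_const.indicator measurableSet_ball),
    lintegral_indicator_const measurableSet_ball, lintegral_const_mul _ hm]
  gcongr
  · exact hA x
  · exact lintegral_lintegral_indicator_ball_le hθ₀ hθ₂ ht μ hA x

lemma exists_semigroup_le {θ : ℝ} (hθ₀ : 0 < θ) (hθ₂ : θ ≤ 2)
    (μ : Measure E) [SFinite μ] {A : ℝ≥0∞} (hAt : A ≠ ∞) (hA : ∀ x : E, μ (Metric.ball x 1) ≤ A) :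
    ∃ C : ℝ, 0 < C ∧ ∀ t ∈ Ioo (0 : ℝ) 1, ∀ x : E,
      semigroup θ t μ x ≤ ENNReal.ofReal (C * t ^ (-((N : ℝ) / θ))) := by
  set β := volume (Metric.ball (0 : E) (1 / 2)) with hβ
  have hβ0 : β ≠ 0 := (Metric.measure_ball_pos volume 0 (by norm_num)).ne'
  have hk := kernel_nonneg (N := N) hθ₀ hθ₂ one_pos 0
  -- The first term scales as `t^(-N/θ)`; the second is constant in time and is absorbed because
  -- `t^(-N/θ) ≥ 1` for `t < 1`. The last 1 only secures positivity.
  refine ⟨kernel N θ 0 1 * A.toReal + (β⁻¹).toReal * A.toReal + 1, by positivity,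
    fun t ht x => (semigroup_le hθ₀ hθ₂ ht.1 μ hA x).trans ?_⟩
  have htp : 1 ≤ t ^ (-((N : ℝ) / θ)) :=
    Real.one_le_rpow_of_pos_of_le_one_of_nonpos ht.1 ht.2.le (by
      rw [neg_nonpos]; positivity)
  have htp0 : 0 ≤ t ^ (-((N : ℝ) / θ)) := by linarith
  rw [ekernel, kernel_zero_eq hθ₀ ht.1]
  have e1 : A = ENNReal.ofReal A.toReal := (ENNReal.ofReal_toReal hAt).symm
  have e2 : β⁻¹ = ENNReal.ofReal (β⁻¹).toReal :=
    (ENNReal.ofReal_toReal (ENNReal.inv_ne_top.2 hβ0)).symm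
  rw [e1, e2, ← ENNReal.ofReal_mul (by positivity), ← ENNReal.ofReal_mul (by positivity),
    ← ENNReal.ofReal_add (by positivity) (by positivity), ← e1, ← e2]
  refine ENNReal.ofReal_le_ofReal ?_
  have h3 : 0 ≤ (β⁻¹).toReal * A.toReal := by positivity
  nlinarith

end FracHeat

/-! ### Weighted Duhamel operators and the equation shifted by `K`. -/

namespace FracHeat

open Filter Topology Real

variable {N : ℕ}

local notation "E" => EuclideanSpace ℝ (Fin N)

/-- Tonelli on the triangle `0 < r < s < t`, followed by the translation `s ↦ s + r`. -/
lemma lintegral_Ioo_lintegral_Ioo {a b Q : ℝ → ℝ≥0∞} (ha : Measurable a) (hb : Measurable b)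
    (hQ : Measurable Q) (t : ℝ) :
    ∫⁻ s in Ioo 0 t, a (t - s) * ∫⁻ r in Ioo 0 s, b (s - r) * Q r
      = ∫⁻ r in Ioo 0 t, (∫⁻ s in Ioo 0 (t - r), a (t - r - s) * b s) * Q r := by
  set S : Set (ℝ × ℝ) := {p | 0 < p.2 ∧ p.2 < p.1 ∧ p.1 < t} with hS
  have hSm : MeasurableSet S :=
    (measurableSet_lt measurable_const measurable_snd).inter
      ((measurableSet_lt measurable_snd measurable_fst).inter
        (measurableSet_lt measurable_fst measurable_const))
  set g : ℝ × ℝ → ℝ≥0∞ := S.indicator fun p => a (t - p.1) * (b (p.1 - p.2) * Q p.2) with hg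
  have hgm : Measurable g :=
    (by fun_prop : Measurable fun p : ℝ × ℝ => a (t - p.1) * (b (p.1 - p.2) * Q p.2)).indicator hSm
  have hL : ∫⁻ s in Ioo 0 t, a (t - s) * ∫⁻ r in Ioo 0 s, b (s - r) * Q r
      = ∫⁻ s, ∫⁻ r, g (s, r) := by
    rw [← lintegral_indicator measurableSet_Ioo]
    refine lintegral_congr fun s => ?_
    by_cases hs : s ∈ Ioo 0 t
    · rw [indicator_of_mem hs, ← lintegral_const_mul _ (by fun_prop),
        ← lintegral_indicator measurableSet_Ioo]
      refine lintegral_congr fun r => ?_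
      by_cases hr : r ∈ Ioo 0 s
      · rw [indicator_of_mem hr, hg, indicator_of_mem (show (s, r) ∈ S from ⟨hr.1, hr.2, hs.2⟩)]
      · rw [indicator_of_notMem hr, hg, indicator_of_notMem (fun h : (s, r) ∈ S => hr ⟨h.1, h.2.1⟩)]
    · rw [indicator_of_notMem hs, eq_comm, lintegral_eq_zero_iff (by fun_prop)]
      refine Eventually.of_forall fun r => ?_
      exact indicator_of_notMem (fun h : (s, r) ∈ S => hs ⟨h.1.trans h.2.1, h.2.2⟩) _
  have hR : ∫⁻ r in Ioo 0 t, (∫⁻ s in Ioo 0 (t - r), a (t - r - s) * b s) * Q r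
      = ∫⁻ r, ∫⁻ s, g (s, r) := by
    rw [← lintegral_indicator measurableSet_Ioo]
    refine lintegral_congr fun r => ?_
    rw [← lintegral_add_right_eq_self (fun s => g (s, r)) r]
    by_cases hr : r ∈ Ioo 0 t
    · rw [indicator_of_mem hr, ← lintegral_mul_const _ (by fun_prop),
        ← lintegral_indicator measurableSet_Ioo]
      refine lintegral_congr fun s => ?_
      by_cases hs : s ∈ Ioo 0 (t - r)
      · rw [indicator_of_mem hs, hg, indicator_of_mem (show (s + r, r) ∈ S from
          ⟨hr.1, by linarith [hs.1], by linarith [hs.2]⟩)]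
        simp only [add_sub_cancel_right, sub_add_eq_sub_sub_swap, mul_assoc]
      · rw [indicator_of_notMem hs, hg, indicator_of_notMem (fun h : (s + r, r) ∈ S =>
          hs ⟨by linarith [h.2.1], by linarith [h.2.2]⟩)]
    · rw [indicator_of_notMem hr, eq_comm, lintegral_eq_zero_iff (by fun_prop)]
      refine Eventually.of_forall fun s => ?_
      exact indicator_of_notMem (fun h : (s + r, r) ∈ S => hr ⟨h.1, h.2.1.trans h.2.2⟩) _
  rw [hL, hR]
  exact lintegral_lintegral_swap (f := fun s r => g (s, r)) hgm.aemeasurable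

/-- `∫_0^t a(t - s) ∫ Γ_θ(x - y, t - s) f(y, s) dy ds`. -/
def volterra (θ : ℝ) (a : ℝ → ℝ≥0∞) (f : E → ℝ → ℝ≥0∞) (x : E) (t : ℝ) : ℝ≥0∞ :=
  ∫⁻ s in Ioo 0 t, a (t - s) * ∫⁻ y, ekernel θ (x - y) (t - s) * f y s

lemma measurable_lintegral_ekernel (θ : ℝ) {f : E → ℝ → ℝ≥0∞}
    (hf : Measurable (fun p : E × ℝ => f p.1 p.2)) :
    Measurable fun q : (E × ℝ) × ℝ => ∫⁻ y, ekernel θ (q.1.1 - y) (q.1.2 - q.2) * f y q.2 := by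
  refine Measurable.lintegral_prod_right'
    (f := fun p : ((E × ℝ) × ℝ) × E => ekernel θ (p.1.1.1 - p.2) (p.1.1.2 - p.1.2) * f p.2 p.1.2) ?_
  have : Measurable fun p : ((E × ℝ) × ℝ) × E => f p.2 p.1.2 :=
    hf.comp (by fun_prop : Measurable fun p : ((E × ℝ) × ℝ) × E => (p.2, p.1.2))
  fun_prop

lemma measurable_volterra_integrand (θ : ℝ) {a : ℝ → ℝ≥0∞} (ha : Measurable a)
    {f : E → ℝ → ℝ≥0∞} (hf : Measurable (fun p : E × ℝ => f p.1 p.2)) (x : E) (t : ℝ) :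
    Measurable fun s => a (t - s) * ∫⁻ y, ekernel θ (x - y) (t - s) * f y s := by
  have h1 : Measurable fun s : ℝ => ∫⁻ y, ekernel θ (x - y) (t - s) * f y s :=
    (measurable_lintegral_ekernel θ hf).comp
      (by fun_prop : Measurable fun s : ℝ => (((x, t), s) : (E × ℝ) × ℝ))
  fun_prop

lemma measurable_volterra (θ : ℝ) {a : ℝ → ℝ≥0∞} (ha : Measurable a) {f : E → ℝ → ℝ≥0∞}
    (hf : Measurable (fun p : E × ℝ => f p.1 p.2)) :
    Measurable (fun p : E × ℝ => volterra θ a f p.1 p.2) := by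
  have hS : MeasurableSet {q : (E × ℝ) × ℝ | 0 < q.2 ∧ q.2 < q.1.2} :=
    (measurableSet_lt (f := fun _ : (E × ℝ) × ℝ => (0 : ℝ)) (g := fun q => q.2)
      (by fun_prop) (by fun_prop)).inter
      (measurableSet_lt (f := fun q : (E × ℝ) × ℝ => q.2) (g := fun q => q.1.2)
        (by fun_prop) (by fun_prop))
  have h1 := measurable_lintegral_ekernel θ hf
  have h2 : Measurable fun q : (E × ℝ) × ℝ =>
      a (q.1.2 - q.2) * ∫⁻ y, ekernel θ (q.1.1 - y) (q.1.2 - q.2) * f y q.2 := by fun_prop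
  have h3 := (h2.indicator hS).lintegral_prod_right' (ν := (volume : Measure ℝ))
  convert h3 using 2 with p
  rw [volterra, ← lintegral_indicator measurableSet_Ioo]
  rfl

lemma measurable_section {f : E → ℝ → ℝ≥0∞} (hf : Measurable (fun p : E × ℝ => f p.1 p.2))
    (s : ℝ) : Measurable fun y => f y s :=
  hf.comp (by fun_prop : Measurable fun y : E => (y, s))

lemma volterra_mono {θ : ℝ} {a : ℝ → ℝ≥0∞} {f g : E → ℝ → ℝ≥0∞} {x : E} {t : ℝ}
    (h : ∀ s ∈ Ioo 0 t, ∀ y, f y s ≤ g y s) : volterra θ a f x t ≤ volterra θ a g x t :=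
  setLIntegral_mono' measurableSet_Ioo fun s hs => by
    gcongr with y
    exact h s hs y

lemma volterra_congr {θ : ℝ} {a : ℝ → ℝ≥0∞} {f g : E → ℝ → ℝ≥0∞} {x : E} {t : ℝ}
    (h : ∀ s ∈ Ioo 0 t, ∀ y, f y s = g y s) : volterra θ a f x t = volterra θ a g x t :=
  le_antisymm (volterra_mono fun s hs y => (h s hs y).le)
    (volterra_mono fun s hs y => (h s hs y).ge)

lemma volterra_add (θ : ℝ) {a : ℝ → ℝ≥0∞} (ha : Measurable a) {f g : E → ℝ → ℝ≥0∞}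
    (hf : Measurable (fun p : E × ℝ => f p.1 p.2)) (x : E) (t : ℝ) :
    volterra θ a (fun y s => f y s + g y s) x t = volterra θ a f x t + volterra θ a g x t := by
  simp only [volterra]
  rw [← lintegral_add_left (measurable_volterra_integrand θ ha hf x t)]
  refine lintegral_congr fun s => ?_
  rw [← mul_add, ← lintegral_add_left]
  · simp only [mul_add]
  · have := measurable_section hf s
    fun_prop

lemma volterra_const_mul (θ : ℝ) {a : ℝ → ℝ≥0∞} (ha : Measurable a) {f : E → ℝ → ℝ≥0∞}
    (hf : Measurable (fun p : E × ℝ => f p.1 p.2)) (c : ℝ≥0∞) (x : E) (t : ℝ) :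
    volterra θ a (fun y s => c * f y s) x t = c * volterra θ a f x t := by
  simp only [volterra]
  rw [← lintegral_const_mul _ (measurable_volterra_integrand θ ha hf x t)]
  refine lintegral_congr fun s => ?_
  have := measurable_section hf s
  simp only [mul_left_comm (ekernel _ _ _) c]
  rw [lintegral_const_mul _ (by fun_prop), mul_left_comm]

lemma volterra_semigroup {θ : ℝ} (hθ₀ : 0 < θ) (hθ₂ : θ ≤ 2) {a b : ℝ → ℝ≥0∞}
    (ha : Measurable a) (hb : Measurable b) (μ : Measure E) [SFinite μ] (x : E) (t : ℝ) :
    volterra θ a (fun y s => b s * semigroup θ s μ y) x t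
      = (∫⁻ s in Ioo 0 t, a (t - s) * b s) * semigroup θ t μ x := by
  rw [volterra, ← lintegral_mul_const _ (by fun_prop)]
  refine setLIntegral_congr_fun measurableSet_Ioo fun s hs => ?_
  have hm := measurable_section (f := fun y s => semigroup θ s μ y) (measurable_semigroup θ μ) s
  simp only [mul_left_comm _ (b s) _]
  rw [lintegral_const_mul _ (by fun_prop),
    lintegral_ekernel_mul_semigroup hθ₀ hθ₂ hs.1 (sub_pos.2 hs.2), sub_add_cancel, mul_assoc]

/-- The semigroup law merges the two kernels into one independent of the intermediate time, so
composition of the operators is convolution of the weights. -/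
lemma volterra_volterra {θ : ℝ} (hθ₀ : 0 < θ) (hθ₂ : θ ≤ 2) {a b : ℝ → ℝ≥0∞}
    (ha : Measurable a) (hb : Measurable b) {f : E → ℝ → ℝ≥0∞}
    (hf : Measurable (fun p : E × ℝ => f p.1 p.2)) (x : E) (t : ℝ) :
    volterra θ a (volterra θ b f) x t
      = volterra θ (fun r => ∫⁻ s in Ioo 0 r, a (r - s) * b s) f x t := by
  have hm := measurable_lintegral_ekernel θ hf
  have hQ : Measurable fun r : ℝ => ∫⁻ z, ekernel θ (x - z) (t - r) * f z r :=
    hm.comp (by fun_prop : Measurable fun r : ℝ => (((x, t), r) : (E × ℝ) × ℝ))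
  rw [volterra, volterra, ← lintegral_Ioo_lintegral_Ioo ha hb hQ t]
  refine setLIntegral_congr_fun measurableSet_Ioo fun s hs => ?_
  congr 1
  have h2 : Measurable fun p : E × ℝ => ∫⁻ z, ekernel θ (p.1 - z) (s - p.2) * f z p.2 :=
    hm.comp (by fun_prop : Measurable fun p : E × ℝ => (((p.1, s), p.2) : (E × ℝ) × ℝ))
  have h1 : ∀ y, ekernel θ (x - y) (t - s) * volterra θ b f y s = ∫⁻ r in Ioo 0 s,
      ekernel θ (x - y) (t - s) * (b (s - r) * ∫⁻ z, ekernel θ (y - z) (s - r) * f z r) :=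
    fun y => by
      rw [volterra, lintegral_const_mul _ (measurable_volterra_integrand θ hb hf y s)]
  simp only [h1]
  rw [lintegral_lintegral_swap]
  · refine setLIntegral_congr_fun measurableSet_Ioo fun r hr => ?_
    have h3 : Measurable fun y : E => ∫⁻ z, ekernel θ (y - z) (s - r) * f z r :=
      h2.comp (by fun_prop : Measurable fun y : E => (y, r))
    have h4 := measurable_section hf r
    simp only [mul_left_comm _ (b (s - r)) _]
    rw [lintegral_const_mul _ (by fun_prop),
      lintegral_ekernel_mul_lintegral hθ₀ hθ₂ (sub_pos.2 hr.2) (sub_pos.2 hs.2) _ h4,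
      sub_add_sub_cancel]
  · exact Measurable.aemeasurable (by fun_prop)

/-- The weight `exp(-K t)`. -/
def decay (K : ℝ) (t : ℝ) : ℝ≥0∞ := ENNReal.ofReal (Real.exp (-K * t))

@[fun_prop]
lemma measurable_decay (K : ℝ) : Measurable (decay K) := by unfold decay; fun_prop

lemma mul_lintegral_decay_add {K : ℝ} (hK : 0 ≤ K) {t : ℝ} (ht : 0 ≤ t) :
    ENNReal.ofReal K * (∫⁻ s in Ioo 0 t, decay K s) + decay K t = 1 := by
  have hc : Continuous fun s : ℝ => Real.exp (-K * s) := by fun_prop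
  have h1 : ∫⁻ s in Ioo 0 t, decay K s = ENNReal.ofReal (∫ s in (0 : ℝ)..t, Real.exp (-K * s)) := by
    rw [intervalIntegral.integral_of_le ht, ← Measure.restrict_congr_set Ioo_ae_eq_Ioc,
      ofReal_integral_eq_lintegral_ofReal]
    · rfl
    · exact (hc.integrableOn_Icc (a := 0) (b := t)).mono_set Ioo_subset_Icc_self
    · exact Eventually.of_forall fun s => (Real.exp_pos _).le
  have h2 : K * ∫ s in (0 : ℝ)..t, Real.exp (-K * s) = 1 - Real.exp (-K * t) := by
    rw [← intervalIntegral.integral_const_mul]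
    have := intervalIntegral.integral_eq_sub_of_hasDerivAt (a := 0) (b := t)
      (f := fun s : ℝ => -Real.exp (-K * s)) (f' := fun s => K * Real.exp (-K * s))
      (fun s _ => by
        have h := ((hasDerivAt_id s).const_mul (-K)).exp.neg
        simp only [id, mul_one] at h
        refine h.congr_deriv ?_
        ring) ((by fun_prop : Continuous _).intervalIntegrable _ _)
    rw [this]; simp; ring
  have h3 : 0 ≤ 1 - Real.exp (-K * t) := by
    rw [sub_nonneg, Real.exp_le_one_iff]; nlinarith [mul_nonneg hK ht]
  rw [h1, ← ENNReal.ofReal_mul hK, h2, decay, ← ENNReal.ofReal_add h3 (Real.exp_pos _).le]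
  simp

lemma measurable_lintegral_Ioo (a : ℝ → ℝ≥0∞) :
    Measurable fun t => ∫⁻ s in Ioo 0 t, a s := by
  have : Monotone fun t => ∫⁻ s in Ioo 0 t, a s :=
    fun s t hst => lintegral_mono_set (Ioo_subset_Ioo_right hst)
  exact this.measurable

lemma lintegral_Ioo_comp_sub (a : ℝ → ℝ≥0∞) (t : ℝ) :
    ∫⁻ s in Ioo 0 t, a (t - s) = ∫⁻ s in Ioo 0 t, a s := by
  rw [← lintegral_indicator measurableSet_Ioo, ← lintegral_indicator measurableSet_Ioo,
    ← lintegral_sub_left_eq_self _ t]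
  refine lintegral_congr fun s => ?_
  by_cases hs : s ∈ Ioo 0 t
  · rw [indicator_of_mem hs, indicator_of_mem (by constructor <;> linarith [hs.1, hs.2]),
      sub_sub_cancel]
  · rw [indicator_of_notMem hs, indicator_of_notMem
      fun h => hs (by constructor <;> linarith [h.1, h.2])]

lemma volterra_weight_add {θ : ℝ} {a b : ℝ → ℝ≥0∞} (ha : Measurable a) {f : E → ℝ → ℝ≥0∞}
    (hf : Measurable (fun p : E × ℝ => f p.1 p.2)) (c : ℝ≥0∞) (x : E) (t : ℝ)
    (hab : ∀ r, 0 < r → c * a r + b r = 1) :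
    c * volterra θ a f x t + volterra θ b f x t = volterra θ (fun _ => 1) f x t := by
  have hi := measurable_volterra_integrand θ ha hf x t
  simp only [volterra]
  rw [← lintegral_const_mul _ hi, ← lintegral_add_left (hi.const_mul c)]
  refine setLIntegral_congr_fun measurableSet_Ioo fun s hs => ?_
  rw [← mul_assoc, ← add_mul, hab _ (sub_pos.2 hs.2)]

/-- A resolvent identity written without subtraction: on the level of weights it is `K ∫_0^r exp(-K
s) ds + exp(-K r) = 1`. -/
lemma volterra_decay_volterra {θ : ℝ} (hθ₀ : 0 < θ) (hθ₂ : θ ≤ 2) {K : ℝ} (hK : 0 ≤ K)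
    {f : E → ℝ → ℝ≥0∞} (hf : Measurable (fun p : E × ℝ => f p.1 p.2)) (x : E) (t : ℝ) :
    ENNReal.ofReal K * volterra θ (decay K) (volterra θ (fun _ => 1) f) x t
      + volterra θ (decay K) f x t = volterra θ (fun _ => 1) f x t := by
  rw [volterra_volterra hθ₀ hθ₂ (measurable_decay K) measurable_const hf]
  simp only [mul_one, lintegral_Ioo_comp_sub]
  exact volterra_weight_add (measurable_lintegral_Ioo (decay K)) hf _ x t
    fun r hr => mul_lintegral_decay_add hK hr.le

lemma volterra_volterra_decay {θ : ℝ} (hθ₀ : 0 < θ) (hθ₂ : θ ≤ 2) {K : ℝ} (hK : 0 ≤ K)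
    {f : E → ℝ → ℝ≥0∞} (hf : Measurable (fun p : E × ℝ => f p.1 p.2)) (x : E) (t : ℝ) :
    ENNReal.ofReal K * volterra θ (fun _ => 1) (volterra θ (decay K) f) x t
      + volterra θ (decay K) f x t = volterra θ (fun _ => 1) f x t := by
  rw [volterra_volterra hθ₀ hθ₂ measurable_const (measurable_decay K) hf]
  simp only [one_mul]
  exact volterra_weight_add (measurable_lintegral_Ioo (decay K)) hf _ x t
    fun r hr => mul_lintegral_decay_add hK hr.le

/-- A solution of the integral equation solves the equation shifted by `K`. -/
lemma shifted_eq_of_eq {θ : ℝ} (hθ₀ : 0 < θ) (hθ₂ : θ ≤ 2) {K : ℝ} (hK : 0 ≤ K) (μ : Measure E)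
    [SFinite μ] {f v : E → ℝ → ℝ≥0∞} (hf : Measurable (fun p : E × ℝ => f p.1 p.2))
    {x : E} {t : ℝ} (ht : 0 < t)
    (hv : ∀ s ∈ Ioc 0 t, ∀ y, v y s = semigroup θ s μ y + volterra θ (fun _ => 1) f y s) :
    decay K t * semigroup θ t μ x
      + volterra θ (decay K) (fun y s => f y s + ENNReal.ofReal K * v y s) x t = v x t := by
  have hS := measurable_semigroup θ μ
  have hV := measurable_volterra θ (a := fun _ => 1) measurable_const hf
  have hc : volterra θ (decay K) (fun y s => f y s + ENNReal.ofReal K * v y s) x t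
      = volterra θ (decay K) (fun y s => f y s + (ENNReal.ofReal K * (1 * semigroup θ s μ y)
        + ENNReal.ofReal K * volterra θ (fun _ => 1) f y s)) x t :=
    volterra_congr fun s hs y => by rw [hv s ⟨hs.1, hs.2.le⟩ y, one_mul, mul_add]
  rw [hc, volterra_add θ (measurable_decay K) hf, volterra_add θ (measurable_decay K)
    ((hS.const_mul 1).const_mul _), volterra_const_mul θ (measurable_decay K) (hS.const_mul 1),
    volterra_const_mul θ (measurable_decay K) hV,
    volterra_semigroup hθ₀ hθ₂ (measurable_decay K) measurable_const, hv t ⟨ht, le_rfl⟩ x,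
    ← volterra_decay_volterra hθ₀ hθ₂ hK hf]
  simp only [mul_one, lintegral_Ioo_comp_sub]
  have h1 := mul_lintegral_decay_add hK ht.le
  calc _ = (ENNReal.ofReal K * (∫⁻ s in Ioo 0 t, decay K s) + decay K t) * semigroup θ t μ x
        + (ENNReal.ofReal K * volterra θ (decay K) (volterra θ (fun _ => 1) f) x t
          + volterra θ (decay K) f x t) := by ring
    _ = _ := by rw [h1, one_mul]

/-- A solution of the equation shifted by `K` solves the integral equation. -/
lemma eq_of_shifted_eq {θ : ℝ} (hθ₀ : 0 < θ) (hθ₂ : θ ≤ 2) {K : ℝ} (hK : 0 ≤ K) (μ : Measure E)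
    [SFinite μ] {f u : E → ℝ → ℝ≥0∞} (hf : Measurable (fun p : E × ℝ => f p.1 p.2))
    (hum : Measurable (fun p : E × ℝ => u p.1 p.2)) {x : E} {t : ℝ} (ht : 0 < t)
    (hu : ∀ s ∈ Ioc 0 t, ∀ y, u y s = decay K s * semigroup θ s μ y
      + volterra θ (decay K) (fun y s => f y s + ENNReal.ofReal K * u y s) y s)
    (hfin : volterra θ (fun _ => 1) u x t ≠ ∞) :
    u x t = semigroup θ t μ x + volterra θ (fun _ => 1) f x t := by
  have hS := measurable_semigroup θ μ
  set g : E → ℝ → ℝ≥0∞ := fun y s => f y s + ENNReal.ofReal K * u y s with hg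
  have hgm : Measurable (fun p : E × ℝ => g p.1 p.2) := hf.add (hum.const_mul _)
  have hSK : Measurable (fun p : E × ℝ => decay K p.2 * semigroup θ p.2 μ p.1) := by fun_prop
  have h0 : volterra θ (fun _ => 1) u x t
      = volterra θ (fun _ => 1) (fun y s => decay K s * semigroup θ s μ y
        + volterra θ (decay K) g y s) x t :=
    volterra_congr fun s hs y => hu s ⟨hs.1, hs.2.le⟩ y
  rw [volterra_add θ measurable_const hSK, volterra_semigroup hθ₀ hθ₂ measurable_const
    (measurable_decay K)] at h0
  simp only [one_mul] at h0
  have h1 := mul_lintegral_decay_add hK ht.le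
  have h2 := volterra_volterra_decay hθ₀ hθ₂ hK hgm x t
  have h3 : volterra θ (fun _ => 1) g x t
      = volterra θ (fun _ => 1) f x t + ENNReal.ofReal K * volterra θ (fun _ => 1) u x t := by
    rw [hg, volterra_add θ measurable_const hf, volterra_const_mul θ measurable_const hum]
  have hKfin : ENNReal.ofReal K * volterra θ (fun _ => 1) u x t ≠ ∞ :=
    ENNReal.mul_ne_top ENNReal.ofReal_ne_top hfin
  -- In `[0,∞]` the term `K ∫∫ Γ u` can be cancelled only when finite; this is where `hfin` enters.
  refine (ENNReal.add_left_inj hKfin).1 ?_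
  rw [add_assoc, ← h3, ← h2]
  calc u x t + ENNReal.ofReal K * volterra θ (fun _ => 1) u x t
      = (ENNReal.ofReal K * (∫⁻ s in Ioo 0 t, decay K s) + decay K t) * semigroup θ t μ x
        + (ENNReal.ofReal K * volterra θ (fun _ => 1) (volterra θ (decay K) g) x t
          + volterra θ (decay K) g x t) := by
        rw [hu t ⟨ht, le_rfl⟩ x, h0]; ring
    _ = _ := by rw [h1, one_mul]

end FracHeat

/-! ### One-sided Lipschitz majorants of `F` and the limit theorems for the iteration. -/

namespace FracHeat

open Filter Topology Real

/-- The supremum of `F σ + K σ` over `σ = 0` and all `0 ≤ σ < v`. -/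
def shiftedSup (F : ℝ → ℝ) (K : ℝ) (v : ℝ≥0∞) : ℝ≥0∞ :=
  ⨆ σ : ℝ, ⨆ _ : 0 ≤ σ ∧ (σ = 0 ∨ ENNReal.ofReal σ < v), ENNReal.ofReal (F σ + K * σ)

/-- The one-sided Lipschitz majorant `sup_{σ ≤ v} (F σ - K (v - σ))` of `F`. -/
def lipMajorant (F : ℝ → ℝ) (K : ℝ) (v : ℝ≥0∞) : ℝ≥0∞ :=
  shiftedSup F K v - ENNReal.ofReal K * v

lemma le_shiftedSup {F : ℝ → ℝ} {K σ : ℝ} {v : ℝ≥0∞} (h0 : 0 ≤ σ)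
    (h : σ = 0 ∨ ENNReal.ofReal σ < v) : ENNReal.ofReal (F σ + K * σ) ≤ shiftedSup F K v :=
  le_iSup₂_of_le σ ⟨h0, h⟩ le_rfl

lemma shiftedSup_mono (F : ℝ → ℝ) (K : ℝ) : Monotone (shiftedSup F K) := fun _ _ hvw =>
  iSup₂_le fun _ hσ => le_shiftedSup hσ.1 (hσ.2.imp_right fun h => h.trans_le hvw)

lemma measurable_shiftedSup (F : ℝ → ℝ) (K : ℝ) : Measurable (shiftedSup F K) :=
  (shiftedSup_mono F K).measurable

lemma measurable_lipMajorant (F : ℝ → ℝ) (K : ℝ) : Measurable (lipMajorant F K) :=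
  (measurable_shiftedSup F K).sub (measurable_id.const_mul _)

/-- The strict inequality in `shiftedSup` is chosen for this: `σ < ⨆ n, v n` already holds below
some `v n`. The separate case `σ = 0` keeps the value `F 0` when `v = 0`. -/
lemma shiftedSup_iSup (F : ℝ → ℝ) (K : ℝ) (v : ℕ → ℝ≥0∞) :
    shiftedSup F K (⨆ n, v n) = ⨆ n, shiftedSup F K (v n) := by
  refine le_antisymm (iSup₂_le fun σ hσ => ?_)
    (iSup_le fun n => shiftedSup_mono F K (le_iSup v n))
  rcases hσ.2 with h | h
  · exact le_iSup_of_le 0 (le_shiftedSup hσ.1 (Or.inl h))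
  · obtain ⟨n, hn⟩ := lt_iSup_iff.1 h
    exact le_iSup_of_le n (le_shiftedSup hσ.1 (Or.inr hn))

/-- Left continuity of `F` recovers the endpoint that the strict inequality excludes. -/
lemma ofReal_le_shiftedSup {F : ℝ → ℝ} (hF : ContinuousOn F (Ici 0)) (K : ℝ) {τ : ℝ}
    (hτ : 0 ≤ τ) : ENNReal.ofReal (F τ + K * τ) ≤ shiftedSup F K (ENNReal.ofReal τ) := by
  rcases hτ.eq_or_lt with rfl | hτ
  · exact le_shiftedSup le_rfl (Or.inl rfl)
  have h1 : ContinuousAt (fun σ => ENNReal.ofReal (F σ + K * σ)) τ :=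
    ENNReal.continuous_ofReal.continuousAt.comp
      ((hF.continuousAt (Ici_mem_nhds hτ)).add (by fun_prop))
  have h2 : Tendsto (fun σ => ENNReal.ofReal (F σ + K * σ)) (𝓝[<] τ)
      (𝓝 (ENNReal.ofReal (F τ + K * τ))) := h1.tendsto.mono_left nhdsWithin_le_nhds
  refine le_of_tendsto h2 ?_
  filter_upwards [Ioo_mem_nhdsLT hτ] with σ hσ
  exact le_shiftedSup hσ.1.le (Or.inr ((ENNReal.ofReal_lt_ofReal_iff hτ).2 hσ.2))

lemma ofReal_toReal_add_le_shiftedSup {F : ℝ → ℝ} (hF : ContinuousOn F (Ici 0))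
    (hF0 : ∀ τ, 0 ≤ τ → 0 ≤ F τ) {K : ℝ} (hK : 0 ≤ K) {v : ℝ≥0∞} (hv : v ≠ ∞) :
    ENNReal.ofReal (F v.toReal) + ENNReal.ofReal K * v ≤ shiftedSup F K v := by
  have h := ofReal_le_shiftedSup hF K (τ := v.toReal) ENNReal.toReal_nonneg
  rw [ENNReal.ofReal_add (hF0 _ ENNReal.toReal_nonneg) (by positivity), ENNReal.ofReal_mul hK,
    ENNReal.ofReal_toReal hv] at h
  exact h

lemma lipMajorant_add {F : ℝ → ℝ} (hF : ContinuousOn F (Ici 0))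
    (hF0 : ∀ τ, 0 ≤ τ → 0 ≤ F τ) {K : ℝ} (hK : 0 ≤ K) {v : ℝ≥0∞} (hv : v ≠ ∞) :
    lipMajorant F K v + ENNReal.ofReal K * v = shiftedSup F K v :=
  tsub_add_cancel_of_le (le_trans le_add_self (ofReal_toReal_add_le_shiftedSup hF hF0 hK hv))

lemma le_lipMajorant {F : ℝ → ℝ} (hF : ContinuousOn F (Ici 0))
    (hF0 : ∀ τ, 0 ≤ τ → 0 ≤ F τ) {K : ℝ} (hK : 0 ≤ K) {v : ℝ≥0∞} (hv : v ≠ ∞) :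
    ENNReal.ofReal (F v.toReal) ≤ lipMajorant F K v :=
  ENNReal.le_sub_of_add_le_right (ENNReal.mul_ne_top ENNReal.ofReal_ne_top hv)
    (ofReal_toReal_add_le_shiftedSup hF hF0 hK hv)

lemma shiftedSup_add_le {F : ℝ → ℝ} (hF0 : ∀ τ, 0 ≤ τ → 0 ≤ F τ) {K L : ℝ} (hK : 0 ≤ K)
    (hL : 0 ≤ L) (v : ℝ≥0∞) :
    shiftedSup F (K + L) v ≤ shiftedSup F K v + ENNReal.ofReal L * v := by
  refine iSup₂_le fun σ hσ => ?_
  have h1 : F σ + (K + L) * σ = (F σ + K * σ) + L * σ := by ring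
  rw [h1, ENNReal.ofReal_add (add_nonneg (hF0 _ hσ.1) (mul_nonneg hK hσ.1))
    (mul_nonneg hL hσ.1), ENNReal.ofReal_mul hL]
  refine add_le_add (le_shiftedSup hσ.1 hσ.2) (mul_le_mul_right ?_ _)
  rcases hσ.2 with h | h
  · simp [h]
  · exact h.le

lemma lipMajorant_le {F : ℝ → ℝ} (hF0 : ∀ τ, 0 ≤ τ → 0 ≤ F τ) {K : ℝ} (hK : 0 ≤ K) (v : ℝ≥0∞) :
    lipMajorant F K v ≤ shiftedSup F 0 v := by
  refine tsub_le_iff_right.2 ?_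
  simpa using shiftedSup_add_le hF0 le_rfl hK v

/-- Competitors `σ` within `δ` of the limit are controlled by continuity. Those below the limit by
`δ` or more pay a penalty of at least `n δ/2`, which eventually outweighs the bound `M` of `F`. None
lie above, since `σ ≤ v n`. -/
lemma eventually_lipMajorant_le {F : ℝ → ℝ} (hF : ContinuousOn F (Ici 0)) {v : ℕ → ℝ≥0∞}
    {l : ℝ≥0∞} (hv : ∀ n, v n ≠ ∞) (hl : l ≠ ∞) (hlim : Tendsto v atTop (𝓝 l)) {ε : ℝ}
    (hε : 0 < ε) :
    ∀ᶠ n : ℕ in atTop, lipMajorant F n (v n) ≤ ENNReal.ofReal (F l.toReal + ε) := by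
  set τ := l.toReal with hτ
  have hτ0 : 0 ≤ τ := ENNReal.toReal_nonneg
  have hlim' : Tendsto (fun n => (v n).toReal) atTop (𝓝 τ) := (ENNReal.tendsto_toReal hl).comp hlim
  obtain ⟨δ, hδ, hδF⟩ := Metric.continuousOn_iff.1 hF τ hτ0 ε hε
  obtain ⟨M, hM⟩ := (isCompact_Icc (a := (0 : ℝ)) (b := τ + δ)).exists_bound_of_continuousOn
    (hF.mono Icc_subset_Ici_self)
  have hnat : ∀ᶠ n : ℕ in atTop, (M - (F τ + ε)) / (δ / 2) ≤ (n : ℝ) :=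
    tendsto_natCast_atTop_atTop.eventually_ge_atTop _
  filter_upwards [hnat, hlim'.eventually (Metric.ball_mem_nhds τ (half_pos hδ))] with n hn hvn
  rw [Real.dist_eq, abs_lt] at hvn
  rw [div_le_iff₀ (half_pos hδ)] at hn
  refine tsub_le_iff_right.2 (iSup₂_le fun σ hσ => ?_)
  have hσv : σ ≤ (v n).toReal := by
    rcases hσ.2 with h | h
    · rw [h]; exact ENNReal.toReal_nonneg
    · exact (ENNReal.ofReal_le_iff_le_toReal (hv n)).1 h.le
  have hreal : F σ + n * σ ≤ (F τ + ε) + n * (v n).toReal := by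
    have hn0 : (0 : ℝ) ≤ n := Nat.cast_nonneg n
    by_cases hστ : dist σ τ < δ
    · have h1 := hδF σ hσ.1 hστ
      rw [Real.dist_eq, abs_lt] at h1
      have h2 := mul_le_mul_of_nonneg_left hσv hn0
      linarith
    · rw [Real.dist_eq, not_lt] at hστ
      have h3 : σ ≤ τ - δ := by
        rcases le_abs.1 hστ with h | h <;> linarith
      have h4 : F σ ≤ M := (le_abs_self _).trans (hM σ ⟨hσ.1, by linarith⟩)
      have h5 : (n : ℝ) * (δ / 2) ≤ n * ((v n).toReal - σ) :=
        mul_le_mul_of_nonneg_left (by linarith) hn0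
      linarith
  refine (ENNReal.ofReal_le_ofReal hreal).trans (ENNReal.ofReal_add_le.trans ?_)
  rw [ENNReal.ofReal_mul (Nat.cast_nonneg n), ENNReal.ofReal_toReal (hv n)]

lemma tendsto_lipMajorant {F : ℝ → ℝ} (hF : ContinuousOn F (Ici 0))
    (hF0 : ∀ τ, 0 ≤ τ → 0 ≤ F τ) {v : ℕ → ℝ≥0∞} {l : ℝ≥0∞} (hv : ∀ n, v n ≠ ∞) (hl : l ≠ ∞)
    (hlim : Tendsto v atTop (𝓝 l)) :
    Tendsto (fun n : ℕ => lipMajorant F n (v n)) atTop (𝓝 (ENNReal.ofReal (F l.toReal))) := by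
  have hlim' : Tendsto (fun n => (v n).toReal) atTop (𝓝[Ici 0] l.toReal) :=
    tendsto_nhdsWithin_iff.2 ⟨(ENNReal.tendsto_toReal hl).comp hlim,
      Eventually.of_forall fun n => ENNReal.toReal_nonneg⟩
  have hlow : Tendsto (fun n => ENNReal.ofReal (F (v n).toReal)) atTop
      (𝓝 (ENNReal.ofReal (F l.toReal))) :=
    ENNReal.tendsto_ofReal ((hF l.toReal ENNReal.toReal_nonneg).tendsto.comp hlim')
  refine tendsto_order.2 ⟨fun a ha => ?_, fun b hb => ?_⟩
  · filter_upwards [hlow.eventually (lt_mem_nhds ha)] with n hn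
    exact hn.trans_le (le_lipMajorant hF hF0 (Nat.cast_nonneg n) (hv n))
  · have hc : Tendsto (fun ε : ℝ => ENNReal.ofReal (F l.toReal + ε)) (𝓝[>] 0)
        (𝓝 (ENNReal.ofReal (F l.toReal))) := by
      have : Continuous fun ε : ℝ => ENNReal.ofReal (F l.toReal + ε) :=
        ENNReal.continuous_ofReal.comp (by fun_prop)
      simpa using (this.tendsto 0).mono_left nhdsWithin_le_nhds
    obtain ⟨ε, hε, hεb⟩ := ((hc.eventually (gt_mem_nhds hb)).and self_mem_nhdsWithin).exists.imp
      fun ε h => And.intro h.2 h.1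
    filter_upwards [eventually_lipMajorant_le hF hv hl hlim hε] with n hn
    exact hn.trans_lt hεb

variable {N : ℕ}

local notation "E" => EuclideanSpace ℝ (Fin N)

lemma volterra_iSup (θ : ℝ) {a : ℝ → ℝ≥0∞} (ha : Measurable a) {f : ℕ → E → ℝ → ℝ≥0∞}
    (hf : ∀ n, Measurable (fun p : E × ℝ => f n p.1 p.2)) (hmono : Monotone f) (x : E) (t : ℝ) :
    volterra θ a (fun y s => ⨆ n, f n y s) x t = ⨆ n, volterra θ a (f n) x t := by
  simp only [volterra]
  rw [← lintegral_iSup (fun n => measurable_volterra_integrand θ ha (hf n) x t)]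
  · refine lintegral_congr fun s => ?_
    rw [← ENNReal.mul_iSup, ← lintegral_iSup]
    · simp only [ENNReal.mul_iSup]
    · intro n
      have := measurable_section (hf n) s
      fun_prop
    · intro m n hmn y
      simp only
      gcongr
      exact hmono hmn y s
  · intro m n hmn s
    simp only
    gcongr
    exact hmono hmn _ s

/-- Monotone iteration below a supersolution of the shifted equation. -/
lemma exists_shifted_solution (θ K : ℝ) (F : ℝ → ℝ) (μ : Measure E) [SFinite μ] {T : ℝ}
    {v : E → ℝ → ℝ≥0∞}
    (hv : ∀ t ∈ Ioo 0 T, ∀ x, decay K t * semigroup θ t μ x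
      + volterra θ (decay K) (fun y s => shiftedSup F K (v y s)) x t ≤ v x t) :
    ∃ u : E → ℝ → ℝ≥0∞, Measurable (fun p : E × ℝ => u p.1 p.2) ∧
      (∀ t x, u x t = decay K t * semigroup θ t μ x
        + volterra θ (decay K) (fun y s => shiftedSup F K (u y s)) x t) ∧
      ∀ t ∈ Ioo 0 T, ∀ x, u x t ≤ v x t := by
  set Φ : (E → ℝ → ℝ≥0∞) → E → ℝ → ℝ≥0∞ := fun f x t => decay K t * semigroup θ t μ x
      + volterra θ (decay K) (fun y s => shiftedSup F K (f y s)) x t with hΦ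
  -- Iterates from zero increase because `Φ` is monotone; their supremum is a fixed point for all
  -- `t`, possibly infinite outside `(0,T)`.
  set u : ℕ → E → ℝ → ℝ≥0∞ := fun n => Φ^[n] (fun _ _ => 0) with hu
  have hsucc : ∀ n, u (n + 1) = Φ (u n) := fun n => Function.iterate_succ_apply' Φ n _
  have hΦmono : Monotone Φ := fun f g hfg x t => by
    refine add_le_add_right (volterra_mono fun s _ y => ?_) _
    exact shiftedSup_mono F K (hfg y s)
  have hmono : Monotone u := hΦmono.monotone_iterate_of_le_map fun _ _ => zero_le
  have hS := measurable_semigroup θ μ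
  have hmeas : ∀ n, Measurable (fun p : E × ℝ => u n p.1 p.2) := by
    intro n
    induction n with
    | zero => exact measurable_const
    | succ n ih =>
      rw [hsucc]
      have := measurable_volterra θ (measurable_decay K)
        (f := fun y s => shiftedSup F K (u n y s)) ((measurable_shiftedSup F K).comp ih)
      simp only [hΦ]
      fun_prop
  have hle : ∀ n, ∀ t ∈ Ioo 0 T, ∀ x, u n x t ≤ v x t := by
    intro n
    induction n with
    | zero => exact fun _ _ _ => zero_le
    | succ n ih =>
      intro t ht x
      rw [hsucc]
      refine le_trans (add_le_add_right (volterra_mono fun s hs y => ?_) _) (hv t ht x)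
      exact shiftedSup_mono F K (ih s ⟨hs.1, hs.2.trans ht.2⟩ y)
  refine ⟨fun x t => ⨆ n, u n x t, Measurable.iSup hmeas, fun t x => ?_,
    fun t ht x => iSup_le fun n => hle n t ht x⟩
  simp only [shiftedSup_iSup]
  rw [volterra_iSup θ (measurable_decay K)
    (fun n => (measurable_shiftedSup F K).comp (hmeas n))
    (fun m n hmn y s => shiftedSup_mono F K (hmono hmn y s)), ENNReal.add_iSup]
  have h1 : ∀ n, decay K t * semigroup θ t μ x
      + volterra θ (decay K) (fun y s => shiftedSup F K (u n y s)) x t = u (n + 1) x t :=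
    fun n => by rw [hsucc]
  simp only [h1]
  exact ((show Monotone fun n => u n x t from fun m n h => hmono h x t).iSup_nat_add 1).symm

/-- Dominated convergence in time and then in space; finiteness of the double integral of `h` gives
a finite spatial majorant for almost every `s`. -/
lemma volterra_tendsto (θ : ℝ) {f : ℕ → E → ℝ → ℝ≥0∞} {g h : E → ℝ → ℝ≥0∞}
    (hf : ∀ n, Measurable (fun p : E × ℝ => f n p.1 p.2))
    (hh : Measurable (fun p : E × ℝ => h p.1 p.2)) {x : E} {t : ℝ}
    (hfin : volterra θ (fun _ => 1) h x t ≠ ∞) (hfh : ∀ n, ∀ s ∈ Ioo 0 t, ∀ y, f n y s ≤ h y s)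
    (hlim : ∀ s ∈ Ioo 0 t, ∀ y, Tendsto (fun n => f n y s) atTop (𝓝 (g y s))) :
    Tendsto (fun n => volterra θ (fun _ => 1) (f n) x t) atTop
      (𝓝 (volterra θ (fun _ => 1) g x t)) := by
  have hmh := measurable_volterra_integrand θ (a := fun _ => 1) measurable_const hh x t
  refine tendsto_lintegral_of_dominated_convergence _
    (fun n => measurable_volterra_integrand θ (a := fun _ => 1) measurable_const (hf n) x t)
    (fun n => ?_) hfin ?_
  · filter_upwards [ae_restrict_mem measurableSet_Ioo] with s hs
    gcongr with y
    exact hfh n s hs y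
  · filter_upwards [ae_restrict_mem measurableSet_Ioo, ae_lt_top hmh hfin] with s hs hfs
    simp only [one_mul] at hfs ⊢
    refine tendsto_lintegral_of_dominated_convergence _ (fun n => ?_) (fun n => ?_) hfs.ne ?_
    · have := measurable_section (hf n) s
      fun_prop
    · refine Eventually.of_forall fun y => ?_
      simp only
      gcongr
      exact hfh n s hs y
    · refine Eventually.of_forall fun y => ?_
      refine ENNReal.Tendsto.const_mul (hlim s hs y) (Or.inr ?_)
      rw [ekernel]; exact ENNReal.ofReal_ne_top

end FracHeat

/-! ### A decreasing sequence of majorant solutions and its limit. -/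

namespace FracHeat

open Filter Topology Real

variable {N : ℕ}

local notation "E" => EuclideanSpace ℝ (Fin N)

/-- `u` is a measurable solution on `(0,T)` of the integral equation with nonlinearity
`lipMajorant F K`, lying below `w`. -/
structure IsMajorantSolution (θ K : ℝ) (F : ℝ → ℝ) (μ : Measure E) (T : ℝ)
    (w u : E → ℝ → ℝ≥0∞) : Prop where
  meas : Measurable (fun p : E × ℝ => u p.1 p.2)
  le : ∀ t ∈ Ioo 0 T, ∀ x, u x t ≤ w x t
  eq : ∀ t ∈ Ioo 0 T, ∀ x, u x t = semigroup θ t μ x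
    + volterra θ (fun _ => 1) (fun y s => lipMajorant F K (u y s)) x t

variable {θ : ℝ} {F : ℝ → ℝ} {μ : Measure (EuclideanSpace ℝ (Fin N))} [SFinite μ] {T : ℝ}
  {w : EuclideanSpace ℝ (Fin N) → ℝ → ℝ≥0∞}

lemma exists_isMajorantSolution_of_shifted (hθ₀ : 0 < θ) (hθ₂ : θ ≤ 2)
    (hF : ContinuousOn F (Ici 0)) (hF0 : ∀ τ, 0 ≤ τ → 0 ≤ F τ) {K : ℝ} (hK : 0 ≤ K)
    (hwfin : ∀ t ∈ Ioo 0 T, ∀ x, w x t ≠ ∞)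
    (hwint : ∀ t ∈ Ioo 0 T, ∀ x, volterra θ (fun _ => 1) w x t ≠ ∞)
    {v : E → ℝ → ℝ≥0∞} (hvw : ∀ t ∈ Ioo 0 T, ∀ x, v x t ≤ w x t)
    (hv : ∀ t ∈ Ioo 0 T, ∀ x, decay K t * semigroup θ t μ x
      + volterra θ (decay K) (fun y s => shiftedSup F K (v y s)) x t ≤ v x t) :
    ∃ u, IsMajorantSolution θ K F μ T w u ∧ ∀ t ∈ Ioo 0 T, ∀ x, u x t ≤ v x t := by
  obtain ⟨u, hum, hueq, huv⟩ := exists_shifted_solution θ K F μ hv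
  have huw : ∀ t ∈ Ioo 0 T, ∀ x, u x t ≤ w x t := fun t ht x => (huv t ht x).trans (hvw t ht x)
  have hufin : ∀ t ∈ Ioo 0 T, ∀ x, u x t ≠ ∞ := fun t ht x =>
    ne_top_of_le_ne_top (hwfin t ht x) (huw t ht x)
  refine ⟨u, ⟨hum, huw, fun t ht x => ?_⟩, huv⟩
  refine eq_of_shifted_eq hθ₀ hθ₂ hK μ ((measurable_lipMajorant F K).comp hum) hum ht.1 ?_ ?_
  · intro s hs y
    rw [hueq s y]
    congr 1
    refine volterra_congr fun r hr z => ?_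
    exact (lipMajorant_add hF hF0 hK
      (hufin r ⟨hr.1, hr.2.trans (hs.2.trans_lt ht.2)⟩ z)).symm
  · exact ne_top_of_le_ne_top (hwint t ht x)
      (volterra_mono fun s hs y => huw s ⟨hs.1, hs.2.trans ht.2⟩ y)

/-- Rewritten with shift `K + 1`, the equation of `v` shows that `v` is a supersolution at the next
level, because `shiftedSup` grows by at most `v` when the slope grows by 1. -/
lemma IsMajorantSolution.exists_next (hθ₀ : 0 < θ) (hθ₂ : θ ≤ 2)
    (hF : ContinuousOn F (Ici 0)) (hF0 : ∀ τ, 0 ≤ τ → 0 ≤ F τ) {K : ℝ} (hK : 0 ≤ K)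
    (hwfin : ∀ t ∈ Ioo 0 T, ∀ x, w x t ≠ ∞)
    (hwint : ∀ t ∈ Ioo 0 T, ∀ x, volterra θ (fun _ => 1) w x t ≠ ∞)
    {v : E → ℝ → ℝ≥0∞} (hv : IsMajorantSolution θ K F μ T w v) :
    ∃ u, IsMajorantSolution θ (K + 1) F μ T w u ∧ ∀ t ∈ Ioo 0 T, ∀ x, u x t ≤ v x t := by
  refine exists_isMajorantSolution_of_shifted hθ₀ hθ₂ hF hF0 (by linarith) hwfin hwint hv.le ?_
  intro t ht x
  have h := shifted_eq_of_eq hθ₀ hθ₂ (K := K + 1) (by linarith) μ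
    (f := fun y s => lipMajorant F K (v y s)) (v := v)
    ((measurable_lipMajorant F K).comp hv.meas) (x := x) ht.1
    (fun s hs y => hv.eq s ⟨hs.1, hs.2.trans_lt ht.2⟩ y)
  refine le_trans (add_le_add_right (volterra_mono fun s hs y => ?_) _) h.le
  refine (shiftedSup_add_le hF0 hK zero_le_one _).trans ?_
  rw [← lipMajorant_add hF hF0 hK
    (ne_top_of_le_ne_top (hwfin s ⟨hs.1, hs.2.trans ht.2⟩ y) (hv.le s ⟨hs.1, hs.2.trans ht.2⟩ y)),
    ENNReal.ofReal_add hK zero_le_one, add_mul, add_assoc]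

/-- A supersolution for the running maximum of `F` bounds a solution for `F`. -/
theorem exists_solution_of_supersolution (hθ₀ : 0 < θ) (hθ₂ : θ ≤ 2)
    (hF : ContinuousOn F (Ici 0)) (hF0 : ∀ τ, 0 ≤ τ → 0 ≤ F τ)
    (hwm : Measurable (fun p : E × ℝ => w p.1 p.2))
    (hwfin : ∀ t ∈ Ioo 0 T, ∀ x, w x t ≠ ∞)
    (hwint : ∀ t ∈ Ioo 0 T, ∀ x, volterra θ (fun _ => 1) w x t ≠ ∞)
    (hw : ∀ t ∈ Ioo 0 T, ∀ x, semigroup θ t μ x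
      + volterra θ (fun _ => 1) (fun y s => shiftedSup F 0 (w y s)) x t ≤ w x t) :
    ∃ u : E → ℝ → ℝ≥0∞, Measurable (fun p : E × ℝ => u p.1 p.2) ∧
      (∀ t ∈ Ioo 0 T, ∀ x, u x t ≤ w x t) ∧
      ∀ t ∈ Ioo 0 T, ∀ x, u x t = semigroup θ t μ x
        + volterra θ (fun _ => 1) (fun y s => ENNReal.ofReal (F (u y s).toReal)) x t := by
  -- At slope 0 the majorant is the running maximum of `F` and the weight is 1, so the hypothesis on
  -- `w` starts the sequence.
  have hdecay : decay 0 = fun _ => 1 := by funext t; simp [decay]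
  obtain ⟨u₀, hu₀, -⟩ := exists_isMajorantSolution_of_shifted hθ₀ hθ₂ hF hF0 le_rfl hwfin hwint
    (v := w) (μ := μ) (fun _ _ _ => le_rfl) (by simpa [hdecay] using hw)
  have hnext : ∀ (n : ℕ) (v : {v // IsMajorantSolution θ n F μ T w v}),
      ∃ u, IsMajorantSolution θ ((n + 1 : ℕ) : ℝ) F μ T w u ∧
        ∀ t ∈ Ioo 0 T, ∀ x, u x t ≤ v.1 x t := fun n v => by
    rw [Nat.cast_add_one]
    exact v.2.exists_next hθ₀ hθ₂ hF hF0 (Nat.cast_nonneg n) hwfin hwint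
  choose next hnextsol hnextle using hnext
  let seq : ∀ n : ℕ, {v // IsMajorantSolution θ n F μ T w v} :=
    Nat.rec ⟨u₀, by simpa using hu₀⟩ fun n v => ⟨next n v, hnextsol n v⟩
  set u : ℕ → E → ℝ → ℝ≥0∞ := fun n => (seq n).1 with hu
  have hsol : ∀ n : ℕ, IsMajorantSolution θ n F μ T w (u n) := fun n => (seq n).2
  have hanti : ∀ t ∈ Ioo 0 T, ∀ x, Antitone fun n => u n x t := fun t ht x =>
    antitone_nat_of_succ_le fun n => hnextle n (seq n) t ht x
  have hufin : ∀ n, ∀ t ∈ Ioo 0 T, ∀ x, u n x t ≠ ∞ := fun n t ht x =>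
    ne_top_of_le_ne_top (hwfin t ht x) ((hsol n).le t ht x)
  have hlim : ∀ t ∈ Ioo 0 T, ∀ x, Tendsto (fun n => u n x t) atTop (𝓝 (⨅ n, u n x t)) :=
    fun t ht x => tendsto_atTop_iInf (hanti t ht x)
  have hle : ∀ t ∈ Ioo 0 T, ∀ x, (⨅ n, u n x t) ≤ w x t := fun t ht x =>
    (iInf_le _ 0).trans ((hsol 0).le t ht x)
  refine ⟨fun x t => ⨅ n, u n x t, Measurable.iInf fun n => (hsol n).meas, hle, fun t ht x => ?_⟩
  -- The dominating function is the running maximum of `F` at `w`; its Duhamel integral is finite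
  -- because the supersolution inequality bounds it by `w`.
  have hv := volterra_tendsto θ (f := fun n y s => lipMajorant F n (u n y s))
    (g := fun y s => ENNReal.ofReal (F (⨅ n, u n y s).toReal))
    (h := fun y s => shiftedSup F 0 (w y s)) (x := x) (t := t)
    (fun n => (measurable_lipMajorant F n).comp (hsol n).meas)
    ((measurable_shiftedSup F 0).comp hwm)
    (ne_top_of_le_ne_top (hwfin t ht x) (le_trans le_add_self (hw t ht x)))
    (fun n s hs y => (lipMajorant_le hF0 (Nat.cast_nonneg n) _).trans
      (shiftedSup_mono F 0 ((hsol n).le s ⟨hs.1, hs.2.trans ht.2⟩ y)))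
    (fun s hs y => by
      have hs' : s ∈ Ioo 0 T := ⟨hs.1, hs.2.trans ht.2⟩
      exact tendsto_lipMajorant hF hF0 (fun n => hufin n s hs' y)
        (ne_top_of_le_ne_top (hwfin s hs' y) (hle s hs' y)) (hlim s hs' y))
  refine tendsto_nhds_unique (hlim t ht x) ?_
  have h2 := hv.const_add (semigroup θ t μ x)
  refine h2.congr fun n => ?_
  exact ((hsol n).eq t ht x).symm

end FracHeat

/-! ### The supersolution `2 S(t)μ + R`. -/

namespace FracHeat

open Filter Topology Real

/-- When `R = 0` the supersolution has no room for an additive constant, so `M = 0` is needed; it is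
admissible because `F σ ≤ σ F 1` on `(0,1)` forces `F 0 ≤ 0`. -/
lemma exists_bound_on_Icc {F : ℝ → ℝ} (hF : ContinuousOn F (Ici 0))
    {R : ℝ} (hR : 0 ≤ R) (hA1 : MonotoneOn (fun τ : ℝ => τ⁻¹ * F τ) (Ioi R)) :
    ∃ M, 0 ≤ M ∧ (∀ σ ∈ Icc 0 R, F σ ≤ M) ∧ (R = 0 → M = 0) := by
  rcases hR.eq_or_lt with rfl | hR
  · refine ⟨0, le_rfl, fun σ hσ => ?_, fun _ => rfl⟩
    obtain rfl : σ = 0 := le_antisymm hσ.2 hσ.1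
    have h1 : Tendsto F (𝓝[>] 0) (𝓝 (F 0)) :=
      (hF 0 self_mem_Ici).tendsto.mono_left (nhdsWithin_mono _ Ioi_subset_Ici_self)
    have h2 : Tendsto (fun σ : ℝ => σ * F 1) (𝓝[>] 0) (𝓝 0) := by
      have : Continuous fun σ : ℝ => σ * F 1 := by fun_prop
      simpa using (this.tendsto 0).mono_left nhdsWithin_le_nhds
    refine le_of_tendsto_of_tendsto h1 h2 ?_
    filter_upwards [Ioo_mem_nhdsGT (zero_lt_one' ℝ)] with σ hσ
    have h3 := hA1 hσ.1 (mem_Ioi.2 one_pos) hσ.2.le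
    simp only [inv_one, one_mul] at h3
    rwa [inv_mul_le_iff₀ hσ.1] at h3
  · obtain ⟨M, hM⟩ := (isCompact_Icc (a := (0 : ℝ)) (b := R)).exists_bound_of_continuousOn
      (hF.mono Icc_subset_Ici_self)
    refine ⟨M, (norm_nonneg _).trans (hM 0 ⟨le_rfl, hR.le⟩),
      fun σ hσ => (le_abs_self _).trans (hM σ hσ), fun h => absurd h hR.ne'⟩

/-- Values `σ ≤ R` contribute at most `M`; for `R < σ ≤ τ`, (A1) gives `F σ ≤ (F τ / τ) σ`, a bound
linear in `v`. -/
lemma shiftedSup_zero_le {F : ℝ → ℝ} (hF0 : ∀ τ, 0 ≤ τ → 0 ≤ F τ) {R M τ : ℝ}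
    (hM : ∀ σ ∈ Icc 0 R, F σ ≤ M) (hA1 : MonotoneOn (fun τ : ℝ => τ⁻¹ * F τ) (Ioi R))
    (hR : 0 ≤ R) (hτ : R < τ) {v : ℝ≥0∞} (hv : v ≤ ENNReal.ofReal τ) :
    shiftedSup F 0 v ≤ ENNReal.ofReal M + ENNReal.ofReal (τ⁻¹ * F τ) * v := by
  refine iSup₂_le fun σ hσ => ?_
  rw [zero_mul, add_zero]
  rcases le_or_gt σ R with h | h
  · exact le_add_right (ENNReal.ofReal_le_ofReal (hM σ ⟨hσ.1, h⟩))
  · refine le_add_left ?_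
    have hσ0 : 0 < σ := hR.trans_lt h
    have hσv : ENNReal.ofReal σ < v := hσ.2.resolve_left hσ0.ne'
    have hστ : σ ≤ τ :=
      (ENNReal.ofReal_le_ofReal_iff (hR.trans hτ.le)).1 (hσv.le.trans hv)
    have h1 : F σ ≤ (τ⁻¹ * F τ) * σ := by
      have h2 := hA1 h hτ hστ
      simp only at h2
      rwa [inv_mul_le_iff₀ hσ0, mul_comm σ] at h2
    refine (ENNReal.ofReal_le_ofReal h1).trans ?_
    rw [ENNReal.ofReal_mul (mul_nonneg (inv_nonneg.2 (hR.trans hτ.le)) (hF0 _ (hR.trans hτ.le)))]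
    gcongr

/-- The growth rate `F(τ)/τ` at `τ = C s^{-N/θ}` is integrable near `s = 0`. -/
lemma integrableOn_rate {F : ℝ → ℝ} {n θ C : ℝ} (hn : 0 < n) (hθ : 0 < θ) (hC : 1 < C)
    (hA2 : IntegrableOn (fun τ : ℝ => τ ^ (-(1 + θ / n) - 1) * F τ) (Ioi 1)) :
    IntegrableOn (fun s : ℝ => (C * s ^ (-(n / θ)))⁻¹ * F (C * s ^ (-(n / θ)))) (Ioo 0 1) := by
  have hC0 : 0 < C := by linarith
  set g : ℝ → ℝ := (Ioi (1 : ℝ)).indicator fun τ : ℝ => τ ^ (-(1 + θ / n) - 1) * F τ with hg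
  have h1 : IntegrableOn g (Ioi 0) := (hA2.integrable_indicator measurableSet_Ioi).integrableOn
  have h2 : IntegrableOn (fun τ => g (C * τ)) (Ioi 0) :=
    (integrableOn_Ioi_comp_mul_left_iff g 0 hC0).2 (by simpa using h1)
  have hp : -(n / θ) ≠ 0 := (neg_neg_of_pos (div_pos hn hθ)).ne
  have h3 := ((integrableOn_Ioi_comp_rpow_iff (fun τ => g (C * τ)) hp).2 h2).mono_set
    (Ioo_subset_Ioi_self : Ioo (0 : ℝ) 1 ⊆ Ioi 0)
  refine IntegrableOn.congr_fun (h3.const_mul ((n / θ)⁻¹ * C ^ (1 + θ / n))) (fun s hs => ?_)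
    measurableSet_Ioo
  have hs1 : 1 ≤ s ^ (-(n / θ)) := Real.one_le_rpow_of_pos_of_le_one_of_nonpos hs.1 hs.2.le
    (neg_neg_of_pos (div_pos hn hθ)).le
  have hτ : C * s ^ (-(n / θ)) ∈ Ioi (1 : ℝ) := by
    rw [mem_Ioi]; nlinarith
  have hspos : 0 < s ^ (-(n / θ)) := by linarith
  simp only [hg, indicator_of_mem hτ, smul_eq_mul]
  rw [abs_neg, abs_of_pos (div_pos hn hθ), Real.mul_rpow hC0.le hspos.le, ← Real.rpow_mul hs.1.le,
    mul_inv]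
  have e1 : C ^ (1 + θ / n) * C ^ (-(1 + θ / n) - 1) = C⁻¹ := by
    rw [← Real.rpow_add hC0, ← Real.rpow_neg_one]; congr 1; ring
  have e2 : s ^ (-(n / θ) - 1) * s ^ (-(n / θ) * (-(1 + θ / n) - 1)) = (s ^ (-(n / θ)))⁻¹ := by
    rw [← Real.rpow_add hs.1, ← Real.rpow_neg hs.1.le]; congr 1; field_simp; ring
  have e3 : (n / θ)⁻¹ * (n / θ) = 1 := inv_mul_cancel₀ (div_pos hn hθ).ne'
  calc _ = ((n / θ)⁻¹ * (n / θ)) * (C ^ (1 + θ / n) * C ^ (-(1 + θ / n) - 1))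
        * (s ^ (-(n / θ) - 1) * s ^ (-(n / θ) * (-(1 + θ / n) - 1))) * F (C * s ^ (-(n / θ))) := by
        ring
    _ = _ := by rw [e1, e2, e3]; ring

lemma exists_setLIntegral_Ioo_le {b : ℝ → ℝ≥0∞} (hb : ∫⁻ s in Ioo 0 1, b s ≠ ∞) {ε : ℝ≥0∞}
    (hε : ε ≠ 0) : ∃ T, 0 < T ∧ T ≤ 1 ∧ ∫⁻ s in Ioo 0 T, b s ≤ ε := by
  obtain ⟨δ, hδ, h⟩ := exists_pos_setLIntegral_lt_of_measure_lt hb hε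
  obtain ⟨T, hT0, hTδ⟩ : ∃ T : ℝ, 0 < T ∧ ENNReal.ofReal T < δ := by
    obtain ⟨r, hr0, hr⟩ := ENNReal.lt_iff_exists_nnreal_btwn.1 hδ
    exact ⟨r, by exact_mod_cast hr0, by simpa using hr⟩
  refine ⟨min T 1, lt_min hT0 one_pos, min_le_right _ _, ?_⟩
  have h1 := h (Ioo 0 (min T 1)) (lt_of_le_of_lt (Measure.restrict_apply_le _ _) (by
    rw [Real.volume_Ioo, sub_zero]
    exact (ENNReal.ofReal_le_ofReal (min_le_left _ _)).trans_lt hTδ))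
  rw [Measure.restrict_restrict measurableSet_Ioo,
    inter_eq_left.2 (Ioo_subset_Ioo_right (min_le_right _ _))] at h1
  exact h1.le

variable {N : ℕ}

local notation "E" => EuclideanSpace ℝ (Fin N)

lemma volterra_const {θ : ℝ} (hθ₀ : 0 < θ) (hθ₂ : θ ≤ 2) {b : ℝ → ℝ≥0∞} (x : E) (t : ℝ) :
    volterra θ (fun _ => 1) (fun _ s => b s) x t = ∫⁻ s in Ioo 0 t, b s := by
  refine setLIntegral_congr_fun measurableSet_Ioo fun s hs => ?_
  simp only [one_mul]
  rw [lintegral_mul_const _ (by fun_prop), lintegral_ekernel_sub hθ₀ hθ₂ (sub_pos.2 hs.2), one_mul]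

/-- Propagating `2 S(s)μ + c` from time `s` to `t` gives `2 S(t)μ + c`, so the time weight factors
out. -/
lemma volterra_mul_supersolution {θ : ℝ} (hθ₀ : 0 < θ) (hθ₂ : θ ≤ 2) (μ : Measure E) [SFinite μ]
    {b : ℝ → ℝ≥0∞} (hb : Measurable b) (c : ℝ≥0∞) (x : E) (t : ℝ) :
    volterra θ (fun _ => 1) (fun y s => b s * (2 * semigroup θ s μ y + c)) x t
      = (∫⁻ s in Ioo 0 t, b s) * (2 * semigroup θ t μ x + c) := by
  have hS := measurable_semigroup θ μ
  have h1 : volterra θ (fun _ => 1) (fun y s => b s * (2 * semigroup θ s μ y + c)) x t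
      = volterra θ (fun _ => 1) (fun y s => 2 * (b s * semigroup θ s μ y) + c * b s) x t :=
    volterra_congr fun s _ y => by ring
  have hbS : Measurable (fun p : E × ℝ => b p.2 * semigroup θ p.2 μ p.1) := by fun_prop
  rw [h1, volterra_add θ measurable_const (hbS.const_mul 2), volterra_const_mul θ measurable_const
    hbS, volterra_semigroup hθ₀ hθ₂ measurable_const hb, volterra_const hθ₀ hθ₂ (b := fun s => c * b s),
    lintegral_const_mul c hb]
  simp only [one_mul]
  ring

lemma duhamel_eq_volterra (θ : ℝ) (F : ℝ → ℝ) (u : E → ℝ → ℝ) (x : E) (t : ℝ) :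
    duhamel θ F u x t
      = volterra θ (fun _ => 1) (fun y s => ENNReal.ofReal (F (u y s))) x t := by
  simp only [duhamel, volterra, ekernel, one_mul]

/-- The budget is `S + R/2 + (2S + R)/2 = 2S + R`: the middle term pays for `M t`, the last for the
linear part. -/
lemma volterra_shiftedSup_le {θ : ℝ} (hθ₀ : 0 < θ) (hθ₂ : θ ≤ 2) (μ : Measure E) [SFinite μ]
    {F : ℝ → ℝ} {b : ℝ → ℝ≥0∞} (hb : Measurable b) {M R : ℝ} {x : E} {t : ℝ}
    (hle : ∀ s ∈ Ioo 0 t, ∀ y : E, shiftedSup F 0 (2 * semigroup θ s μ y + ENNReal.ofReal R)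
      ≤ ENNReal.ofReal M + b s * (2 * semigroup θ s μ y + ENNReal.ofReal R))
    (hM0 : 0 ≤ M) (hMt : M * t ≤ R / 2)
    (hbt : ∫⁻ s in Ioo 0 t, b s ≤ 2⁻¹) :
    semigroup θ t μ x + volterra θ (fun _ => 1)
        (fun y s => shiftedSup F 0 (2 * semigroup θ s μ y + ENNReal.ofReal R)) x t
      ≤ 2 * semigroup θ t μ x + ENNReal.ofReal R := by
  calc _ ≤ semigroup θ t μ x + volterra θ (fun _ => 1) (fun y s => ENNReal.ofReal M
        + b s * (2 * semigroup θ s μ y + ENNReal.ofReal R)) x t := by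
        gcongr
        exact volterra_mono hle
    _ = semigroup θ t μ x + (ENNReal.ofReal (M * t)
        + (∫⁻ s in Ioo 0 t, b s) * (2 * semigroup θ t μ x + ENNReal.ofReal R)) := by
        rw [volterra_add θ measurable_const measurable_const,
          volterra_const hθ₀ hθ₂ (b := fun _ => ENNReal.ofReal M),
          volterra_mul_supersolution hθ₀ hθ₂ μ hb, setLIntegral_const, Real.volume_Ioo, sub_zero,
          ← ENNReal.ofReal_mul hM0]
    _ ≤ semigroup θ t μ x + (ENNReal.ofReal (R / 2)
        + 2⁻¹ * (2 * semigroup θ t μ x + ENNReal.ofReal R)) := by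
        gcongr
    _ = semigroup θ t μ x + (2⁻¹ * ENNReal.ofReal R
        + 2⁻¹ * (2 * semigroup θ t μ x + ENNReal.ofReal R)) := by
        rw [show R / 2 = 2⁻¹ * R by ring, ENNReal.ofReal_mul (by norm_num),
          ENNReal.ofReal_inv_of_pos two_pos, ENNReal.ofReal_ofNat]
    _ = semigroup θ t μ x + (2⁻¹ * 2) * semigroup θ t μ x
        + (2⁻¹ + 2⁻¹) * ENNReal.ofReal R := by ring
    _ = _ := by
        rw [ENNReal.inv_mul_cancel two_ne_zero ENNReal.ofNat_ne_top, ENNReal.inv_two_add_inv_two]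
        ring

end FracHeat

end

/-! ### Choice of constants and conclusion. -/

theorem theorem4p1 (N : ℕ) (hN : 1 ≤ N) (θ : ℝ) (hθ₀ : 0 < θ) (hθ₂ : θ ≤ 2)
    (F : ℝ → ℝ) (hFcont : ContinuousOn F (Set.Ici 0)) (hFnonneg : ∀ τ : ℝ, 0 ≤ τ → 0 ≤ F τ)
    (R : ℝ) (hR : 0 ≤ R) (hA1 : MonotoneOn (fun τ : ℝ => τ⁻¹ * F τ) (Set.Ioi R))
    (hA2 : MeasureTheory.IntegrableOn
      (fun τ : ℝ => τ ^ (-(1 + θ / (N : ℝ)) - 1) * F τ) (Set.Ioi 1))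
    (μ : MeasureTheory.Measure (EuclideanSpace ℝ (Fin N)))
    [MeasureTheory.IsLocallyFiniteMeasure μ]
    (hμ : (⨆ x : EuclideanSpace ℝ (Fin N), μ (Metric.ball x 1)) < ∞) :
    ∃ T : ℝ, 0 < T ∧ ∃ C : ℝ, 0 < C ∧ ∃ u : EuclideanSpace ℝ (Fin N) → ℝ → ℝ,
      FracHeat.IsSolution θ F μ T u ∧
      ∀ x : EuclideanSpace ℝ (Fin N), ∀ t ∈ Set.Ioo 0 T,
        0 ≤ u x t ∧
        ENNReal.ofReal (u x t) ≤ 2 * FracHeat.semigroup θ t μ x + ENNReal.ofReal R ∧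
        2 * FracHeat.semigroup θ t μ x + ENNReal.ofReal R
          ≤ ENNReal.ofReal (C * t ^ (-((N : ℝ) / θ))) := by
  have hN0 : (0 : ℝ) < N := by exact_mod_cast hN
  obtain ⟨C₁, hC₁, hSC⟩ := FracHeat.exists_semigroup_le hθ₀ hθ₂ μ hμ.ne (le_iSup _)
  -- The part `2 C₁ + R` bounds the supersolution by `τ`; the extra 2 ensures `C > 1` for
  -- `integrableOn_rate`.
  set C : ℝ := 2 * C₁ + R + 2 with hC
  have hC1 : 1 < C := by linarith
  have hC0 : 0 < C := by linarith
  set τ : ℝ → ℝ := fun s => C * s ^ (-((N : ℝ) / θ)) with hτ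
  have hpow : ∀ s ∈ Ioo (0 : ℝ) 1, 1 ≤ s ^ (-((N : ℝ) / θ)) := fun s hs =>
    Real.one_le_rpow_of_pos_of_le_one_of_nonpos hs.1 hs.2.le
      (neg_neg_of_pos (div_pos hN0 hθ₀)).le
  have hτR : ∀ s ∈ Ioo (0 : ℝ) 1, R < τ s := fun s hs => by
    have := hpow s hs
    simp only [hτ]
    nlinarith
  have hwC : ∀ s ∈ Ioo (0 : ℝ) 1, ∀ y,
      2 * FracHeat.semigroup θ s μ y + ENNReal.ofReal R ≤ ENNReal.ofReal (τ s) := by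
    intro s hs y
    have h1 := hpow s hs
    calc 2 * FracHeat.semigroup θ s μ y + ENNReal.ofReal R
        ≤ 2 * ENNReal.ofReal (C₁ * s ^ (-((N : ℝ) / θ))) + ENNReal.ofReal R := by
          gcongr; exact hSC s hs y
      _ = ENNReal.ofReal (2 * (C₁ * s ^ (-((N : ℝ) / θ))) + R) := by
          rw [ENNReal.ofReal_add (by positivity) hR, ENNReal.ofReal_mul (by norm_num : (0:ℝ) ≤ 2),
            ENNReal.ofReal_ofNat]
      _ ≤ _ := by
          refine ENNReal.ofReal_le_ofReal ?_
          simp only [hτ, hC]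
          nlinarith
  -- `F` is controlled only on `[0,∞)`; the maximum makes `b` measurable on the whole line without
  -- changing it on `(0,1)`.
  set b : ℝ → ℝ≥0∞ := fun s => ENNReal.ofReal ((τ s)⁻¹ * F (max (τ s) 0)) with hb
  have hτm : Measurable τ := by fun_prop
  have hbm : Measurable b := by
    have hFm : Continuous fun r => F (max r 0) :=
      hFcont.comp_continuous (by fun_prop) fun r => mem_Ici.2 (le_max_right r 0)
    exact (hτm.inv.mul (hFm.measurable.comp hτm)).ennreal_ofReal
  have hbeq : ∀ s ∈ Ioo (0 : ℝ) 1, b s = ENNReal.ofReal ((τ s)⁻¹ * F (τ s)) := fun s hs => by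
    simp only [hb]; rw [max_eq_left (hR.trans (hτR s hs).le)]
  have hbfin : ∫⁻ s in Ioo 0 1, b s ≠ ∞ := by
    rw [setLIntegral_congr_fun measurableSet_Ioo hbeq]
    exact (FracHeat.integrableOn_rate hN0 hθ₀ hC1 hA2).lintegral_lt_top.ne
  obtain ⟨T₁, hT₁, hT₁1, hT₁b⟩ := FracHeat.exists_setLIntegral_Ioo_le hbfin
    (ε := 2⁻¹) (by simp)
  obtain ⟨M, hM0, hM, hMR⟩ := FracHeat.exists_bound_on_Icc hFcont hR hA1
  obtain ⟨T₂, hT₂, hMT⟩ : ∃ T₂ : ℝ, 0 < T₂ ∧ M * T₂ ≤ R / 2 := by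
    rcases hR.eq_or_lt with h | h
    · exact ⟨1, one_pos, by rw [hMR h.symm, ← h]; norm_num⟩
    -- `M + 1` in place of `M` covers the case `M = 0`.
    · refine ⟨R / (2 * (M + 1)), by positivity, ?_⟩
      rw [← mul_div_assoc, div_le_div_iff₀ (by positivity) two_pos]
      nlinarith
  set T := min T₁ T₂ with hT
  have hTT : ∀ t ∈ Ioo 0 T, t ∈ Ioo (0 : ℝ) 1 ∧ t ≤ T₁ ∧ t ≤ T₂ := fun t ht =>
    ⟨⟨ht.1, (ht.2.trans_le (min_le_left _ _)).trans_le hT₁1⟩,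
      (ht.2.trans_le (min_le_left _ _)).le, (ht.2.trans_le (min_le_right _ _)).le⟩
  have hS := FracHeat.measurable_semigroup θ μ
  obtain ⟨u, hum, huw, hueq⟩ := FracHeat.exists_solution_of_supersolution (μ := μ) (T := T)
    (w := fun x t => 2 * FracHeat.semigroup θ t μ x + ENNReal.ofReal R) hθ₀ hθ₂ hFcont hFnonneg
    (by fun_prop) (fun t ht x => ne_top_of_le_ne_top ENNReal.ofReal_ne_top (hwC t (hTT t ht).1 x))
    (fun t ht x => by
      have h := FracHeat.volterra_mul_supersolution hθ₀ hθ₂ μ (b := fun _ => 1) measurable_const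
        (ENNReal.ofReal R) x t
      simp only [one_mul] at h
      rw [h]
      refine ENNReal.mul_ne_top (by simp) ?_
      exact ne_top_of_le_ne_top ENNReal.ofReal_ne_top (hwC t (hTT t ht).1 x))
    (fun t ht x => by
      obtain ⟨ht1, htT₁, htT₂⟩ := hTT t ht
      refine FracHeat.volterra_shiftedSup_le hθ₀ hθ₂ μ hbm (M := M) (fun s hs y => ?_) hM0
        ((mul_le_mul_of_nonneg_left htT₂ hM0).trans hMT)
        ((lintegral_mono_set (Ioo_subset_Ioo_right htT₁)).trans hT₁b)
      have hs1 : s ∈ Ioo (0 : ℝ) 1 := ⟨hs.1, hs.2.trans ht1.2⟩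
      rw [hbeq s hs1]
      exact FracHeat.shiftedSup_zero_le hFnonneg hM hA1 hR (hτR s hs1) (hwC s hs1 y))
  have hofReal : ∀ t ∈ Ioo 0 T, ∀ x, ENNReal.ofReal (u x t).toReal = u x t := fun t ht x =>
    ENNReal.ofReal_toReal (ne_top_of_le_ne_top ENNReal.ofReal_ne_top
      ((huw t ht x).trans (hwC t (hTT t ht).1 x)))
  refine ⟨T, lt_min hT₁ hT₂, C, hC0, fun x t => (u x t).toReal, ⟨?_, ?_, ?_⟩, fun x t ht => ?_⟩
  · exact hum.ennreal_toReal.aemeasurable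
  · exact fun x t _ => ENNReal.toReal_nonneg
  · refine ae_restrict_of_forall_mem (MeasurableSet.univ.prod measurableSet_Ioo) fun z hz => ?_
    rw [FracHeat.duhamel_eq_volterra, hofReal z.2 hz.2 z.1]
    exact hueq z.2 hz.2 z.1
  · refine ⟨ENNReal.toReal_nonneg, ?_, hwC t (hTT t ht).1 x⟩
    rw [hofReal t ht x]
    exact huw t ht x
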